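/- **Fans, Chow rings and mixed volumes.** Let $\Delta$ be a simplicial fan in a real vector space $V$ with finitely many rays $\rho_j$, $j\in L$, each with a fixed generator $v_j$. Its Chow ring is $$\operatorname{CH}(\Delta)=\mathbb R[\partial_j]_{j\in L}\Big/\Big(\prod_{j\in S}\partial_j\ (S \text{ does not span a cone of } \Delta),\ \ \sum_{j\in L} l(v_j)\,\partial_j\ (l\in V^*)\Big).$$ For $d\ge 0$, a degree map is a linear map $\deg:\operatorname{CH}^d(\Delta)\to\mathbb R$ such that $\deg\big(\prod_{j\in\sigma}\partial_j\big)=1$ for every $d$-dimensional cone $\sigma$ of $\Delta$ (it corresponds to the constant Minkowski weight $1$). If there is exactly one degree map, the mixed volume of $\Delta$ is the homogeneous polynomial of degree $d$ $$\operatorname{Vol}_\Delta=\sum_{|a|=d}\deg(\partial^a)\,\frac{x^a}{a!}\in\mathbb R[x_j]_{j\in L}.$$ **Matroids.** Let $M$ be a loopless matroid of rank $d+1$ on a finite set $E$. A flat is nontrivial if it is different from $\emptyset$ and $E$. Write $e_F=\sum_{a\in F}e_a$. The Bergman fan $\Delta_M$ in $\mathbb R^E/\mathbb R e_E$ has a ray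 $\rho_F$ generated by $e_F$ for every nontrivial flat $F$, and its cones are spanned by the chains of nontrivial flats. Let $\operatorname{Vol}_M=\operatorname{Vol}_{\Delta_M}$. Let $i\in E$ be such that $\{i\}$ is a flat of $M$, and assume that $i$ is not a coloop. Let $S_i$ be the set of all $F$ such that $F$ and $F\cup i$ are distinct nontrivial flats of $M$, and let $k=|S_i|$. The fan $\Delta_k$ in $\mathbb R^E/\mathbb R e_E$, obtained from $\Delta_M$ by undoing the $k$ star subdivisions at the cones with rays $\rho_i,\rho_F$ ($F\in S_i$) that add the rays $\rho_{F\cup i}$, is the following: identify $F\cup i$ with $F$ for every $F\in S_i$; the rays of $\Delta_k$ are the resulting classes of nontrivial flats, a class $\{F,F\cup i\}$ with $F\in S_i$ has generator $e_F$, a singleton class $\{F\}$ has generator $e_F$, and the cones of $\Delta_k$ are the images of the chains of nontrivial flats of $M$. The rays of $\Delta_k$ are $\rho_i$ and the rays $\rho_{\overline G}$, where $G$ runs over the nontrivial flats of $M\smallsetminus i$ and $\overline G$ is the closure of $G$ in $M$. **Theorem.** The fans $\Delta_{M\smallsetminus i}$ and $\Delta_k$ have exactly one degree map on $\operatorname{CH}^d$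 each, so that $\operatorname{Vol}_{M\smallsetminus i}$ and $\operatorname{Vol}_{\Delta_k}$ are defined. There are real numbers $b_{\overline G}$, indexed by the nontrivial flats $G$ of $M\smallsetminus i$, such that $$\partial_i=\sum_{G} b_{\overline G}\,\partial_{\overline G}\qquad\text{in }\operatorname{CH}(\Delta_k),$$ and for every choice of such numbers $$\operatorname{Vol}_{\Delta_k}=\operatorname{Vol}_{M\smallsetminus i}\big(x_{\overline G}+b_{\overline G}\,x_i\big),$$ that is, $\operatorname{Vol}_{\Delta_k}$ is obtained from $\operatorname{Vol}_{M\smallsetminus i}$ by substituting $x_{\overline G}+b_{\overline G}x_i$ for $x_G$. -/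

import Mathlib

open MvPolynomial
open scoped Matroid

noncomputable section

/-- A simplicial fan in a real vector space `V` with rays indexed by `ι`. A cone is recorded as the
finite set of its rays, and `gen j` is the fixed generator of the ray `j`. The generators of the
rays of a cone are linearly independent, so that the cone is embedded in `V`. -/
structure SimplicialFan (ι V : Type*) [AddCommGroup V] [Module ℝ V] where
  cones : Set (Finset ι)
  zero_mem : ∅ ∈ cones
  ray_mem : ∀ j, {j} ∈ cones
  face_mem : ∀ σ ∈ cones, ∀ τ ⊆ σ, τ ∈ cones
  gen : ι → V
  indep : ∀ σ ∈ cones, LinearIndepOn ℝ gen (σ : Set ι)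

namespace SimplicialFan

variable {ι V : Type*} [AddCommGroup V] [Module ℝ V]

/-- The square-free monomial `∂_σ`. The variable `X j` of the polynomial ring stands for the
piecewise linear function `∂_j` with value `1` at `gen j` and `0` at the other generators. -/
def coneMonomial (σ : Finset ι) : MvPolynomial ι ℝ := ∏ j ∈ σ, X j

theorem coneMonomial_isHomogeneous {d : ℕ} {σ : Finset ι} (h : σ.card = d) :
    (coneMonomial σ).IsHomogeneous d := by
  have := IsHomogeneous.prod σ (fun j => (X j : MvPolynomial ι ℝ)) (fun _ => 1)
    (fun j _ => isHomogeneous_X ℝ j)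
  simpa [coneMonomial, h] using this

/-- The ideal of the Stanley-Reisner ring `𝒜(Δ) = ℝ[∂_j] / I`. -/
def stanleyReisnerIdeal (Δ : SimplicialFan ι V) : Ideal (MvPolynomial ι ℝ) :=
  Ideal.span {f | ∃ σ : Finset ι, σ ∉ Δ.cones ∧ f = coneMonomial σ}

variable [Fintype ι]

/-- The restriction to the fan of a global linear function `l`, as a linear form in the `∂_j`. -/
def linearForm (Δ : SimplicialFan ι V) (l : Module.Dual ℝ V) : MvPolynomial ι ℝ :=
  ∑ j, C (l (Δ.gen j)) * X j

/-- The ideal of relations of the Chow ring: `CH(Δ) = 𝒜(Δ) / 𝔪 𝒜(Δ) = ℝ[∂_j] / chowIdeal`. -/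
def chowIdeal (Δ : SimplicialFan ι V) : Ideal (MvPolynomial ι ℝ) :=
  Δ.stanleyReisnerIdeal ⊔ Ideal.span (Set.range Δ.linearForm)

/-- The Chow ring of the fan. -/
abbrev Chow (Δ : SimplicialFan ι V) : Type _ := MvPolynomial ι ℝ ⧸ Δ.chowIdeal

/-- The quotient map from `ℝ[∂_j]` to the Chow ring. -/
def toChow (Δ : SimplicialFan ι V) : MvPolynomial ι ℝ →ₐ[ℝ] Δ.Chow :=
  Ideal.Quotient.mkₐ ℝ Δ.chowIdeal

/-- The graded piece `CH^d(Δ)`. -/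
def chowDeg (Δ : SimplicialFan ι V) (d : ℕ) : Submodule ℝ Δ.Chow :=
  (homogeneousSubmodule ι ℝ d).map Δ.toChow.toLinearMap

theorem toChow_mem {Δ : SimplicialFan ι V} {d : ℕ} {f : MvPolynomial ι ℝ}
    (hf : f.IsHomogeneous d) : Δ.toChow f ∈ Δ.chowDeg d :=
  ⟨f, hf, rfl⟩

/-- `φ : CH^d(Δ) → ℝ` corresponds to the constant Minkowski weight `1`: it takes the value `1` on
`∂_σ` for every `d`-dimensional cone `σ`. -/
def IsDegreeMap (Δ : SimplicialFan ι V) (d : ℕ) (φ : Δ.chowDeg d →ₗ[ℝ] ℝ) : Prop :=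
  ∀ (σ : Finset ι) (_ : σ ∈ Δ.cones) (h : σ.card = d),
    φ ⟨Δ.toChow (coneMonomial σ), toChow_mem (coneMonomial_isHomogeneous h)⟩ = 1

open Classical in
/-- The degree map of a `d`-dimensional fan on which the constant weight `1` is balanced (with
value `0` if there is no such map). -/
def degreeMap (Δ : SimplicialFan ι V) (d : ℕ) : Δ.chowDeg d →ₗ[ℝ] ℝ :=
  if h : ∃ φ, Δ.IsDegreeMap d φ then h.choose else 0

theorem monomial_isHomogeneous_of_mem [DecidableEq ι] {d : ℕ} {a : ι →₀ ℕ}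
    (h : a ∈ (Finset.univ : Finset ι).finsuppAntidiag d) :
    (monomial a (1 : ℝ)).IsHomogeneous d := by
  apply isHomogeneous_monomial
  rw [Finset.mem_finsuppAntidiag] at h
  rw [Finsupp.degree_apply, ← h.1]
  exact Finset.sum_subset (Finset.subset_univ _) (by simp)

open Classical in
/-- The mixed volume polynomial in the variables `x_j` dual to the `∂_j`: the homogeneous
polynomial of degree `d` to which every `f ∈ ℝ[∂_j]_d`, acting as a differential operator, assigns
the number `degreeMap f`. Explicitly it is `∑ deg(∂^a) x^a / a!` over the exponents `a` of
degree `d`. -/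
def mixedVolume (Δ : SimplicialFan ι V) (d : ℕ) : MvPolynomial ι ℝ :=
  ∑ a ∈ ((Finset.univ : Finset ι).finsuppAntidiag d).attach,
    monomial a.1 (Δ.degreeMap d ⟨Δ.toChow (monomial a.1 1),
      toChow_mem (monomial_isHomogeneous_of_mem a.2)⟩ / ∏ j, ((a.1 j).factorial : ℝ))

end SimplicialFan

namespace Matroid

variable {α : Type*}

/-- A flat other than `∅` and the ground set. -/
def IsNontrivialFlat (M : Matroid α) (F : Set α) : Prop :=
  M.IsFlat F ∧ F.Nonempty ∧ F ≠ M.E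

/-- The nontrivial flats, ordered by inclusion. -/
abbrev NontrivialFlat (M : Matroid α) : Type _ := {F : Set α // M.IsNontrivialFlat F}

theorem finite_nontrivialFlat (M : Matroid α) [M.Finite] :
    {F : Set α | M.IsNontrivialFlat F}.Finite :=
  M.ground_finite.finite_subsets.subset fun _ h => h.1.subset_ground

instance (M : Matroid α) [M.Finite] : Fintype M.NontrivialFlat :=
  @Fintype.ofFinite _ M.finite_nontrivialFlat

/-- The space `ℝ^E / e_E`, where `E` is the ground set. -/
abbrev FanSpace (M : Matroid α) : Type _ :=
  (M.E → ℝ) ⧸ Submodule.span ℝ {(1 : M.E → ℝ)}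

/-- The image in `ℝ^E / e_E` of `e_F = ∑_{x ∈ F} e_x`. -/
def flatVector (M : Matroid α) (F : Set α) : M.FanSpace :=
  Submodule.Quotient.mk (Set.indicator {x : M.E | (x : α) ∈ F} 1)

theorem linearIndepOn_flatVector {ι : Type*} (M : Matroid α) (s : ι → Set α) (T : Finset ι)
    (h0 : T.Nonempty → ∃ x ∈ M.E, ∀ j ∈ T, x ∉ s j)
    (h1 : ∀ T' ⊆ T, T'.Nonempty → ∃ j ∈ T', ∃ x ∈ M.E, x ∈ s j ∧ ∀ k ∈ T', k ≠ j → x ∉ s k) :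
    LinearIndepOn ℝ (fun j => M.flatVector (s j)) (T : Set ι) := by
  classical
  rw [linearIndepOn_finset_iff]
  intro f hf
  by_contra! hne
  obtain ⟨j₀, hj₀, hfj₀⟩ := hne
  have hmk : (Submodule.span ℝ {(1 : M.E → ℝ)}).mkQ
      (∑ j ∈ T, f j • Set.indicator {x : M.E | (x : α) ∈ s j} (1 : M.E → ℝ)) = 0 := by
    rw [map_sum]
    simpa [flatVector] using hf
  rw [Submodule.mkQ_apply, Submodule.Quotient.mk_eq_zero, Submodule.mem_span_singleton] at hmk
  obtain ⟨c, hc⟩ := hmk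
  have hev : ∀ x : M.E, c = ∑ j ∈ T, if (x : α) ∈ s j then f j else 0 := by
    intro x
    have := congrFun hc x
    simpa [Finset.sum_apply, Set.indicator_apply] using this
  have hc0 : c = 0 := by
    obtain ⟨x, hxE, hx⟩ := h0 ⟨j₀, hj₀⟩
    rw [hev ⟨x, hxE⟩]
    exact Finset.sum_eq_zero fun j hj => by simp [hx j hj]
  obtain ⟨j, hj, x, hxE, hxj, hx⟩ := h1 (T.filter fun j => f j ≠ 0) (Finset.filter_subset _ _)
    ⟨j₀, by simp [hj₀, hfj₀]⟩
  rw [Finset.mem_filter] at hj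
  have := hev ⟨x, hxE⟩
  rw [hc0, Finset.sum_eq_single_of_mem j hj.1] at this
  · simp only [hxj, if_true] at this
    exact hj.2 this.symm
  · intro k hk hkj
    by_cases hfk : f k = 0
    · simp [hfk]
    · simp [hx k (by simp [hk, hfk]) hkj]

/-- A finite family of sets that forms a chain of distinct nonempty sets can be peeled off from
the top. -/
theorem chain_peel {ι : Type*} (s : ι → Set α) (T : Finset ι) (hT : T.Nonempty)
    (hne : ∀ j ∈ T, (s j).Nonempty) (hinj : ∀ j ∈ T, ∀ k ∈ T, s j = s k → j = k)
    (hch : ∀ j ∈ T, ∀ k ∈ T, s j ⊆ s k ∨ s k ⊆ s j) :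
    ∃ j ∈ T, (∀ k ∈ T, s k ⊆ s j) ∧ ∃ x, x ∈ s j ∧ ∀ k ∈ T, k ≠ j → x ∉ s k := by
  classical
  have key : ∀ U ⊆ T, U.Nonempty → ∃ j ∈ U, ∀ k ∈ U, s k ⊆ s j := by
    intro U hU hUn
    obtain ⟨j, hj⟩ := Finset.exists_maximalFor s U hUn
    refine ⟨j, hj.1, fun k hk => ?_⟩
    rcases hch j (hU hj.1) k (hU hk) with h | h
    · exact hj.2 hk h
    · exact h
  obtain ⟨j, hj, hmax⟩ := key T subset_rfl hT
  refine ⟨j, hj, hmax, ?_⟩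
  by_cases hU : (T.erase j).Nonempty
  · obtain ⟨l, hl, hlmax⟩ := key _ (Finset.erase_subset _ _) hU
    have hl' := Finset.mem_erase.1 hl
    have : ¬ s j ⊆ s l := fun h => hl'.1 (hinj _ hl'.2 _ hj ((hmax l hl'.2).antisymm h))
    obtain ⟨x, hxj, hxl⟩ := Set.not_subset.1 this
    exact ⟨x, hxj, fun k hk hkj hxk => hxl (hlmax k (by simp [hk, hkj]) hxk)⟩
  · obtain ⟨x, hx⟩ := hne j hj
    refine ⟨x, hx, fun k hk hkj => ?_⟩
    exact absurd ⟨k, by simp [hk, hkj]⟩ hU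

theorem chain_compl {M : Matroid α} {ι : Type*} (s : ι → Set α) (T : Finset ι) (hT : T.Nonempty)
    (hs : ∀ j ∈ T, (s j).Nonempty ∧ s j ⊆ M.E ∧ s j ≠ M.E)
    (hch : ∀ j ∈ T, ∀ k ∈ T, s j ⊆ s k ∨ s k ⊆ s j) :
    ∃ x ∈ M.E, ∀ j ∈ T, x ∉ s j := by
  obtain ⟨j, hj⟩ := Finset.exists_maximalFor s T hT
  obtain ⟨x, hxE, hx⟩ := Set.not_subset.1
    (fun h => (hs j hj.1).2.2 ((hs j hj.1).2.1.antisymm h) : ¬ M.E ⊆ s j)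
  refine ⟨x, hxE, fun k hk hxk => hx ?_⟩
  rcases hch j hj.1 k hk with h | h
  · exact hj.2 hk h hxk
  · exact h hxk

/-- The Bergman fan `Δ_M`: the rays are the nontrivial flats, the ray of `F` is generated by `e_F`,
and the cones are the chains of nontrivial flats. -/
def bergmanFan (M : Matroid α) : SimplicialFan M.NontrivialFlat M.FanSpace where
  cones := {σ | IsChain (· ≤ ·) (σ : Set M.NontrivialFlat)}
  zero_mem := by simp
  ray_mem j := by simp
  face_mem σ hσ τ hτ := hσ.mono (by exact_mod_cast hτ)
  gen F := M.flatVector F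
  indep σ hσ := by
    have hch : ∀ j ∈ σ, ∀ k ∈ σ, (j : Set α) ⊆ k ∨ (k : Set α) ⊆ j := fun j hj k hk =>
      hσ.total hj hk
    refine M.linearIndepOn_flatVector (fun F : M.NontrivialFlat => (F : Set α)) σ
      (fun h => chain_compl _ σ h (fun j _ => ⟨j.2.2.1, j.2.1.subset_ground, j.2.2.2⟩) hch) ?_
    intro T hT hTn
    obtain ⟨j, hj, -, x, hx, h⟩ := chain_peel (fun F : M.NontrivialFlat => (F : Set α)) T hTn
      (fun j _ => j.2.2.1) (fun j _ k _ h => Subtype.ext h)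
      (fun j hj k hk => hch j (hT hj) k (hT hk))
    exact ⟨j, hj, x, j.2.1.subset_ground hx, hx, h⟩

/-- The set `S_i = {F₁, …, F_k}` of all sets `F` such that `F` and `F ∪ i` are distinct nontrivial
flats. -/
def deletionSet (M : Matroid α) (i : α) : Set (Set α) :=
  {F | M.IsNontrivialFlat F ∧ M.IsNontrivialFlat (insert i F) ∧ F ≠ insert i F}

theorem notMem_of_mem_deletionSet {M : Matroid α} {i : α} {F : Set α}
    (h : F ∈ M.deletionSet i) : i ∉ F :=
  fun hi => h.2.2 (Set.insert_eq_of_mem hi).symm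

/-- The rays of `Δ_k`. They are the classes of nontrivial flats under the equivalence relation
generated by `F ~ F ∪ i` for `F ∈ S_i`; the class `{F, F ∪ i}` is represented by `F`, so the
rays are the nontrivial flats that are not of the form `F ∪ i` with `F ∈ S_i`. -/
abbrev ContractedRay (M : Matroid α) (i : α) : Type _ :=
  {F : Set α // M.IsNontrivialFlat F ∧ ∀ G ∈ M.deletionSet i, F ≠ insert i G}

instance (M : Matroid α) [M.Finite] (i : α) : Fintype (M.ContractedRay i) :=
  @Fintype.ofFinite _ (M.finite_nontrivialFlat.subset fun _ h => h.1)

open Classical in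
/-- The map that sends a nontrivial flat to the representative of its class: it sends `F ∪ i` to
`F` for every `F ∈ S_i` and fixes all other nontrivial flats. -/
def contractRay (M : Matroid α) (i : α) (F : M.NontrivialFlat) : M.ContractedRay i :=
  if h : (F : Set α) \ {i} ∈ M.deletionSet i then
    ⟨(F : Set α) \ {i}, h.1, fun G _ hG => by
      have : i ∈ (F : Set α) \ {i} := hG ▸ Set.mem_insert i G
      simp at this⟩
  else
    ⟨F, F.2, fun G hG hFG => h (by
      rw [hFG, Set.insert_sdiff_self_of_notMem (notMem_of_mem_deletionSet hG)]
      exact hG)⟩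

theorem contractRay_sdiff (M : Matroid α) (i : α) (F : M.NontrivialFlat) :
    (M.contractRay i F : Set α) \ {i} = (F : Set α) \ {i} := by
  unfold contractRay
  split_ifs <;> simp

theorem contractRay_subset (M : Matroid α) (i : α) (F : M.NontrivialFlat) :
    (M.contractRay i F : Set α) ⊆ F := by
  unfold contractRay
  split_ifs <;> simp

theorem contractRay_eq_self {M : Matroid α} {i : α} (j : M.ContractedRay i) :
    M.contractRay i ⟨j, j.2.1⟩ = j := by
  unfold contractRay
  split_ifs with h
  · by_cases hi : i ∈ (j : Set α)
    · exact absurd (Set.insert_sdiff_self_of_mem hi).symm (j.2.2 _ h)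
    · exact Subtype.ext (Set.sdiff_singleton_eq_self hi)
  · rfl

theorem contractRay_eq_of_insert {M : Matroid α} {i : α} {F G : M.NontrivialFlat}
    (hi : i ∉ (F : Set α)) (h : (G : Set α) = insert i (F : Set α)) :
    M.contractRay i G = M.contractRay i F := by
  have hF : (F : Set α) ∈ M.deletionSet i :=
    ⟨F.2, h ▸ G.2, fun h' => hi (h' ▸ Set.mem_insert i _)⟩
  have h1 : (F : Set α) \ {i} = F := Set.sdiff_singleton_eq_self hi
  have h2 : (G : Set α) \ {i} = F := by rw [h, Set.insert_sdiff_self_of_notMem hi]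
  apply Subtype.ext
  simp [contractRay, h1, h2, hF]

theorem contractRay_eq_of_sdiff {M : Matroid α} {i : α} {F G : M.NontrivialFlat}
    (h : (F : Set α) \ {i} = (G : Set α) \ {i}) : M.contractRay i F = M.contractRay i G := by
  by_cases hF : i ∈ (F : Set α) <;> by_cases hG : i ∈ (G : Set α)
  · have : F = G := Subtype.ext (by
      rw [← Set.insert_sdiff_self_of_mem hF, h, Set.insert_sdiff_self_of_mem hG])
    rw [this]
  · rw [Set.sdiff_singleton_eq_self hG] at h
    exact contractRay_eq_of_insert hG (by rw [← h, Set.insert_sdiff_self_of_mem hF])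
  · rw [Set.sdiff_singleton_eq_self hF] at h
    exact (contractRay_eq_of_insert hF (by rw [h, Set.insert_sdiff_self_of_mem hG])).symm
  · rw [Set.sdiff_singleton_eq_self hF, Set.sdiff_singleton_eq_self hG] at h
    rw [Subtype.ext h]

open Classical in
/-- The fan `Δ_k` obtained from `Δ_M` by undoing, for all `F ∈ S_i`, the star subdivision at the
cone with rays `i` and `F` that creates the ray of `F ∪ i`. Its cones are the images of the chains
of nontrivial flats under the identification of `F ∪ i` with `F`, and the ray of the class
`{F, F ∪ i}` is generated by `e_F`. -/
def contractedFan (M : Matroid α) (i : α) : SimplicialFan (M.ContractedRay i) M.FanSpace where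
  cones := {σ | ∃ C : Finset M.NontrivialFlat, IsChain (· ≤ ·) (C : Set M.NontrivialFlat) ∧
    σ = C.image (M.contractRay i)}
  zero_mem := ⟨∅, by simp, by simp⟩
  ray_mem j := ⟨{⟨j, j.2.1⟩}, by simp, by simp [contractRay_eq_self]⟩
  face_mem := by
    rintro σ ⟨C, hC, rfl⟩ τ hτ
    refine ⟨C.filter fun F => M.contractRay i F ∈ τ, hC.mono (fun F hF => (Finset.mem_filter.1 hF).1), ?_⟩
    ext j
    simp only [Finset.mem_image, Finset.mem_filter]
    constructor
    · intro hj
      obtain ⟨F, hF, rfl⟩ := Finset.mem_image.1 (hτ hj)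
      exact ⟨F, ⟨hF, hj⟩, rfl⟩
    · rintro ⟨F, ⟨-, h⟩, rfl⟩
      exact h
  gen F := M.flatVector F
  indep := by
    rintro σ ⟨C, hC, rfl⟩
    have hch : ∀ F ∈ C, ∀ G ∈ C, (F : Set α) ⊆ G ∨ (G : Set α) ⊆ F := fun F hF G hG =>
      hC.total hF hG
    refine M.linearIndepOn_flatVector (fun j : M.ContractedRay i => (j : Set α)) _ ?_ ?_
    · intro h
      obtain ⟨x, hxE, hx⟩ := chain_compl (fun F : M.NontrivialFlat => (F : Set α)) C
        (Finset.image_nonempty.1 h) (fun j _ => ⟨j.2.2.1, j.2.1.subset_ground, j.2.2.2⟩) hch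
      refine ⟨x, hxE, fun j hj hxj => ?_⟩
      obtain ⟨F, hF, rfl⟩ := Finset.mem_image.1 hj
      exact hx F hF (contractRay_subset M i F hxj)
    · intro T hT hTn
      by_cases hU : (T.filter fun j : M.ContractedRay i => (j : Set α) ≠ {i}).Nonempty
      · obtain ⟨j, hj, -, x, hx, hxk⟩ := chain_peel
          (fun j : M.ContractedRay i => (j : Set α) \ {i}) _ hU
          (by
            intro j hj
            by_contra! h
            have h' := Set.sdiff_eq_empty.1 h
            exact (Finset.mem_filter.1 hj).2 (j.2.1.2.1.subset_singleton_iff.1 h'))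
          (by
            intro j hj k hk h
            obtain ⟨F, -, rfl⟩ := Finset.mem_image.1 (hT (Finset.mem_filter.1 hj).1)
            obtain ⟨G, -, rfl⟩ := Finset.mem_image.1 (hT (Finset.mem_filter.1 hk).1)
            simp only [contractRay_sdiff] at h
            exact contractRay_eq_of_sdiff h)
          (by
            intro j hj k hk
            obtain ⟨F, hF, rfl⟩ := Finset.mem_image.1 (hT (Finset.mem_filter.1 hj).1)
            obtain ⟨G, hG, rfl⟩ := Finset.mem_image.1 (hT (Finset.mem_filter.1 hk).1)
            simp only [contractRay_sdiff]
            exact (hch F hF G hG).imp Set.sdiff_subset_sdiff_left Set.sdiff_subset_sdiff_left)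
        refine ⟨j, (Finset.mem_filter.1 hj).1, x, j.2.1.1.subset_ground hx.1, hx.1, ?_⟩
        intro k hk hkj hxk'
        by_cases hki : (k : Set α) = {i}
        · exact hx.2 (hki ▸ hxk')
        · exact hxk k (Finset.mem_filter.2 ⟨hk, hki⟩) hkj ⟨hxk', hx.2⟩
      · have hall : ∀ j ∈ T, (j : Set α) = {i} := fun j hj => by
          by_contra h
          exact hU ⟨j, Finset.mem_filter.2 ⟨hj, h⟩⟩
        obtain ⟨j, hj⟩ := hTn
        have hij : i ∈ (j : Set α) := by simp [hall j hj]
        exact ⟨j, hj, i, j.2.1.1.subset_ground hij, hij, fun k hk hkj =>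
          absurd (Subtype.ext ((hall k hk).trans (hall j hj).symm)) hkj⟩

/-- The ray `ρ_i` of `Δ_k`, for a non-coloop `i` that is a flat. -/
def elementRay (M : Matroid α) (i : α) [M.Loopless] (hflat : M.IsFlat {i})
    (hi : ¬ M.IsColoop i) : M.ContractedRay i :=
  ⟨{i}, ⟨hflat, Set.singleton_nonempty i, fun h => hi (by
      rw [isColoop_iff_sdiff_closure, ← h, Set.sdiff_self]
      intro hl
      exact (Set.singleton_ne_empty i) (hl.symm.trans M.loops_eq_empty))⟩,
    fun G hG h => by
      obtain ⟨x, hx⟩ := hG.1.2.1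
      have hxi : x = i := by
        have : x ∈ ({i} : Set α) := h ▸ Set.mem_insert_of_mem i hx
        exact this
      exact notMem_of_mem_deletionSet hG (hxi ▸ hx)⟩

/-- The ray of `Δ_k` of the closure `Ḡ` in `M` of a nontrivial flat `G` of `M ＼ i`. -/
def closureRay (M : Matroid α) (i : α) (G : (M ＼ {i}).NontrivialFlat) :
    M.ContractedRay i :=
  have hGE : (G : Set α) ⊆ M.E \ {i} := G.2.1.subset_ground
  have hGM : (G : Set α) ⊆ M.E := hGE.trans Set.sdiff_subset
  ⟨M.closure G, ⟨M.isFlat_closure _, G.2.2.1.mono (M.subset_closure _), fun h => by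
      have h1 : (M ＼ {i}).closure (G : Set α) = G := G.2.1.closure
      rw [delete_closure_eq_of_disjoint M (Set.disjoint_singleton_right.2 fun h => (hGE h).2 rfl),
        h] at h1
      exact G.2.2.2 h1.symm⟩,
    fun H hH h => by
      have hGH : (G : Set α) ⊆ H := fun x hx => by
        have : x ∈ insert i H := h ▸ M.subset_closure _ hGM hx
        exact this.resolve_left (hGE hx).2
      have hcl := M.closure_subset_closure hGH
      rw [hH.1.1.closure, h] at hcl
      exact notMem_of_mem_deletionSet hH (hcl (Set.mem_insert i H))⟩

end Matroid

/-!
# Mixed volumes of a Bergman fan under deletion of an element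

A degree map is unique on any simplicial fan `Δ`: if `j ∈ τ`, a linear function with value `1` at
the generator of `j` and `0` at the other generators of `τ` rewrites `∂_j ∂_τ` as a combination of
products `∂_k ∂_τ` with `k ∉ τ`, so that `CH^d` is spanned by the products `∂_σ` over the
`d`-dimensional cones (`SimplicialFan.chowDeg_le_span`).

The same rewriting constructs a degree map when the constant weight `1` is balanced.
`SimplicialFan.wordDegree` is the degree of `∂_τ u₁ ⋯ u_n` for piecewise linear functions
`u₁, …, u_n`, computed one factor at a time. That the result does not depend on the order of the
factors and vanishes if a factor is linear is shown by simultaneous induction on `n`: a linear factor may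
be exchanged with the next one (`SimplicialFan.wordDegree_swap_of_linear`), after which the
induction hypothesis applies on the cones of larger dimension. The result is
`SimplicialFan.IsBalanced.isDegreeFunctional`.

On the Bergman fan of a matroid the weight `1` is balanced (`Matroid.isBalanced_bergmanFan`),
since the flats that extend a chain with a single gap between flats `A` and `B` partition `B \ A`.

Let `N = M ＼ i`. The rays of the contracted fan are the ray of `i` and the rays of the closures of
the nontrivial flats of `N` (`Matroid.rayEquiv`); a set of rays is a cone exactly if its flats
form a chain in `N` and, in case the ray of `i` belongs to it, `G ∪ i` is a flat of `M` for each
of its flats `G`. The linear function `e_i^* - e_j^*` gives `∂_i = ∑ b_G ∂_G` with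
`b_G = [j ∈ G] - [i ∈ cl G]`, for any `j ≠ i`. Substituting this for `∂_i` respects the relations
(`Matroid.toChow_substitution_eq_zero`): if `G ∪ i` is not a flat, then for `j` in its closure but
not in `G ∪ i` only flats incomparable to `G` have nonzero coefficients, and different choices of
`j` agree in the Chow ring of `N`. Composing the degree map of `N` with the substitution gives a
degree map of the contracted fan (`Matroid.isDegreeFunctional_substitution`). On a `d`-dimensional
cone that contains the ray of `i`, a suitable `j` leaves exactly one flat that extends the rest of
the cone to a maximal chain (`Matroid.exists_deletionCoeff`).

Finally, the value of a mixed volume at `t` is the degree of `(∑ t_j ∂_j)^d / d!`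
(`SimplicialFan.IsDegreeFunctional.eval_mixedVolume`), and the substitution takes `∑ t_r ∂_r` to
`∑ (t_G + b_G t_i) ∂_G`.
-/

namespace SimplicialFan

section ChowGeneral

open scoped Classical

variable {ι V : Type*} [AddCommGroup V] [Module ℝ V]

/-! ### Coordinates and links -/

/-- Linear functions on `V` that restrict on each cone `τ` to the basis dual to its generators. -/
theorem exists_dual_coordinates (Δ : SimplicialFan ι V) :
    ∃ c : Finset ι → ι → Module.Dual ℝ V, ∀ τ ∈ Δ.cones, ∀ j ∈ τ, ∀ k ∈ τ,
      c τ j (Δ.gen k) = if k = j then 1 else 0 := by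
  have key : ∀ τ : Finset ι, ∃ c : ι → Module.Dual ℝ V, τ ∈ Δ.cones → ∀ j ∈ τ, ∀ k ∈ τ,
      c j (Δ.gen k) = if k = j then 1 else 0 := by
    intro τ
    by_cases hτ : τ ∈ Δ.cones
    · have hli : LinearIndependent ℝ (fun j : τ => Δ.gen j) := Δ.indep τ hτ
      obtain ⟨g, hg⟩ := (Finsupp.linearCombination ℝ
        fun j : τ => Δ.gen j).exists_leftInverse_of_injective (LinearMap.ker_eq_bot.2 hli)
      refine ⟨fun j => if hj : j ∈ τ then (Finsupp.lapply ⟨j, hj⟩) ∘ₗ g else 0,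
        fun _ j hj k hk => ?_⟩
      have h1 := LinearMap.congr_fun hg (Finsupp.single ⟨k, hk⟩ 1)
      simp only [LinearMap.comp_apply, Finsupp.linearCombination_single, one_smul,
        LinearMap.id_apply] at h1
      simp [hj, h1, Finsupp.single_apply]
    · exact ⟨0, fun h => absurd h hτ⟩
  choose c hc using key
  exact ⟨c, hc⟩

/-- `coordinate Δ τ j` is a linear function on `V` which, for `j ∈ τ ∈ Δ`, takes the value `1` at
the generator `j` and `0` at the other generators of `τ`. -/
def coordinate (Δ : SimplicialFan ι V) : Finset ι → ι → Module.Dual ℝ V :=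
  Δ.exists_dual_coordinates.choose

theorem coordinate_gen {Δ : SimplicialFan ι V} {τ : Finset ι} (hτ : τ ∈ Δ.cones) {j k : ι}
    (hj : j ∈ τ) (hk : k ∈ τ) : Δ.coordinate τ j (Δ.gen k) = if k = j then 1 else 0 :=
  Δ.exists_dual_coordinates.choose_spec τ hτ j hj k hk

theorem coneMonomial_insert [DecidableEq ι] {τ : Finset ι} {k : ι} (hk : k ∉ τ) :
    coneMonomial (insert k τ) = X k * coneMonomial τ := by
  simp [coneMonomial, hk]

theorem monomial_one_eq_prod (a : ι →₀ ℕ) :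
    (monomial a (1 : ℝ)) = (a.toMultiset.map X).prod := by
  rw [monomial_eq, C_1, one_mul, Finsupp.toMultiset_map, Finsupp.prod_toMultiset,
    Finsupp.prod_mapDomain_index (by simp) (by intros; rw [pow_add])]

variable [Fintype ι]

/-- The rays that span a cone of dimension one more together with `τ`. -/
def link (Δ : SimplicialFan ι V) (τ : Finset ι) : Finset ι :=
  Finset.univ.filter fun k => k ∉ τ ∧ insert k τ ∈ Δ.cones

theorem mem_link [inst : DecidableEq ι] {Δ : SimplicialFan ι V} {τ : Finset ι} {k : ι} :
    k ∈ Δ.link τ ↔ k ∉ τ ∧ insert k τ ∈ Δ.cones := by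
  obtain rfl : inst = fun a b => Classical.propDecidable (a = b) := Subsingleton.elim _ _
  simp [link]

/-! ### Uniqueness of the degree map -/

theorem toChow_eq_zero_iff {Δ : SimplicialFan ι V} {f : MvPolynomial ι ℝ} :
    Δ.toChow f = 0 ↔ f ∈ Δ.chowIdeal :=
  Ideal.Quotient.eq_zero_iff_mem

theorem toChow_eq_iff {Δ : SimplicialFan ι V} {f g : MvPolynomial ι ℝ} :
    Δ.toChow f = Δ.toChow g ↔ f - g ∈ Δ.chowIdeal := by
  rw [← toChow_eq_zero_iff, map_sub, sub_eq_zero]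

theorem toChow_coneMonomial_eq_zero {Δ : SimplicialFan ι V} {σ : Finset ι} (h : σ ∉ Δ.cones) :
    Δ.toChow (coneMonomial σ) = 0 :=
  toChow_eq_zero_iff.2 (Ideal.mem_sup_left (Ideal.subset_span ⟨σ, h, rfl⟩))

theorem toChow_linearForm (Δ : SimplicialFan ι V) (l : Module.Dual ℝ V) :
    Δ.toChow (Δ.linearForm l) = 0 :=
  toChow_eq_zero_iff.2 (Ideal.mem_sup_right (Ideal.subset_span ⟨l, rfl⟩))

theorem coneMonomial_mul_monomial_mem_span (Δ : SimplicialFan ι V) (d : ℕ) (s : Multiset ι) :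
    ∀ τ : Finset ι, τ.card + Multiset.card s = d →
      Δ.toChow (coneMonomial τ * (s.map X).prod) ∈
        Submodule.span ℝ {y | ∃ σ ∈ Δ.cones, σ.card = d ∧ y = Δ.toChow (coneMonomial σ)} := by
  induction s using Multiset.induction with
  | empty =>
    intro τ hτ
    by_cases h : τ ∈ Δ.cones
    · exact Submodule.subset_span ⟨τ, h, by simpa using hτ, by simp⟩
    · simp [toChow_coneMonomial_eq_zero h]
  | cons j s ih =>
    intro τ hτ
    by_cases h : τ ∈ Δ.cones
    swap
    · simp [toChow_coneMonomial_eq_zero h]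
    have hstep : ∀ k ∉ τ, Δ.toChow (coneMonomial τ * (X k * (s.map X).prod)) ∈
        Submodule.span ℝ {y | ∃ σ ∈ Δ.cones, σ.card = d ∧ y = Δ.toChow (coneMonomial σ)} := by
      intro k hk
      have := ih (insert k τ) (by
        rw [Finset.card_insert_of_notMem hk]; rw [Multiset.card_cons] at hτ; omega)
      rwa [coneMonomial_insert hk, mul_assoc, mul_left_comm] at this
    rw [Multiset.map_cons, Multiset.prod_cons]
    by_cases hj : j ∈ τ
    · have hX : Δ.toChow (X j) = Δ.toChow
          (∑ k ∈ Finset.univ.filter (· ∉ τ), C (-Δ.coordinate τ j (Δ.gen k)) * X k) := by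
        rw [toChow_eq_iff]
        have h0 := toChow_eq_zero_iff.1 (Δ.toChow_linearForm (Δ.coordinate τ j))
        have h1 : ∑ k ∈ Finset.univ.filter (· ∈ τ), C (Δ.coordinate τ j (Δ.gen k)) * X k =
            (X j : MvPolynomial ι ℝ) := by
          rw [Finset.sum_eq_single_of_mem j (by simpa using hj)]
          · simp [coordinate_gen h hj hj]
          · intro k hk hkj
            simp [coordinate_gen h hj (Finset.mem_filter.1 hk).2, hkj]
        rw [linearForm, ← Finset.sum_filter_add_sum_filter_not Finset.univ (· ∈ τ), h1] at h0
        simpa using h0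
      rw [map_mul, map_mul, hX, ← map_mul, ← map_mul, Finset.sum_mul, Finset.mul_sum, map_sum]
      refine Submodule.sum_mem _ fun k hk => ?_
      have := Submodule.smul_mem _ (-Δ.coordinate τ j (Δ.gen k))
        (hstep k (Finset.mem_filter.1 hk).2)
      rw [← map_smul] at this
      convert this using 2
      rw [MvPolynomial.smul_eq_C_mul]
      ring
    · exact hstep j hj

theorem chowDeg_le_span (Δ : SimplicialFan ι V) (d : ℕ) :
    Δ.chowDeg d ≤
      Submodule.span ℝ {y | ∃ σ ∈ Δ.cones, σ.card = d ∧ y = Δ.toChow (coneMonomial σ)} := by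
  rintro _ ⟨f, hf, rfl⟩
  rw [AlgHom.toLinearMap_apply, f.as_sum, map_sum]
  refine Submodule.sum_mem _ fun a ha => ?_
  have hd : a.degree = d := by
    have := hf (mem_support_iff.1 ha)
    rwa [Finsupp.degree_eq_weight_one]
  have h := Δ.coneMonomial_mul_monomial_mem_span d a.toMultiset ∅ (by
    rw [Finsupp.card_toMultiset, Finset.card_empty, zero_add]
    simpa [Finsupp.degree_apply, Finsupp.sum] using hd)
  rw [← monomial_one_eq_prod] at h
  have h' := Submodule.smul_mem _ (coeff a f) h
  rw [← map_smul] at h'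
  convert h' using 2
  simp [coneMonomial, smul_monomial]

/-- The products `∂_σ` over the `d`-dimensional cones span `CH^d`, so a degree map is determined by
its values on them. -/
theorem IsDegreeMap.unique {Δ : SimplicialFan ι V} {d : ℕ} {φ ψ : Δ.chowDeg d →ₗ[ℝ] ℝ}
    (hφ : Δ.IsDegreeMap d φ) (hψ : Δ.IsDegreeMap d ψ) : φ = ψ := by
  have h : Δ.chowDeg d ≤ (LinearMap.eqLocus φ ψ).map (Δ.chowDeg d).subtype := by
    refine (Δ.chowDeg_le_span d).trans (Submodule.span_le.2 ?_)
    rintro _ ⟨σ, hσ, hc, rfl⟩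
    exact ⟨⟨_, toChow_mem (coneMonomial_isHomogeneous hc)⟩,
      (hφ σ hσ hc).trans (hψ σ hσ hc).symm, rfl⟩
  ext ⟨y, hy⟩
  obtain ⟨z, hz, hzy⟩ := h hy
  have : z = ⟨y, hy⟩ := Subtype.ext hzy
  rw [← this]
  exact hz

end ChowGeneral

section Existence

open scoped Classical

variable {ι V : Type*} [AddCommGroup V] [Module ℝ V]

/-! ### Existence of the degree map -/

/-- A function `u` on the rays stands for a piecewise linear function on the fan. Subtracting the
linear function that agrees with `u` on the cone `τ` makes it vanish on `τ`. -/
def reduce (Δ : SimplicialFan ι V) (τ : Finset ι) : (ι → ℝ) →ₗ[ℝ] (ι → ℝ) where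
  toFun u k := u k - ∑ j ∈ τ, u j * Δ.coordinate τ j (Δ.gen k)
  map_add' u v := by
    ext k
    simp only [Pi.add_apply, add_mul, Finset.sum_add_distrib]
    ring
  map_smul' c u := by
    ext k
    simp only [Pi.smul_apply, smul_eq_mul, RingHom.id_apply, mul_sub, Finset.mul_sum, mul_assoc]

theorem reduce_apply (Δ : SimplicialFan ι V) (τ : Finset ι) (u : ι → ℝ) (k : ι) :
    Δ.reduce τ u k = u k - ∑ j ∈ τ, u j * Δ.coordinate τ j (Δ.gen k) := rfl

theorem reduce_apply_of_mem {Δ : SimplicialFan ι V} {τ : Finset ι} (hτ : τ ∈ Δ.cones)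
    (u : ι → ℝ) {k : ι} (hk : k ∈ τ) : Δ.reduce τ u k = 0 := by
  rw [reduce_apply, Finset.sum_eq_single_of_mem k hk]
  · simp [coordinate_gen hτ hk hk]
  · intro j hj hjk
    simp [coordinate_gen hτ hj hk, hjk.symm]

theorem reduce_eq_self {Δ : SimplicialFan ι V} {τ : Finset ι} {u : ι → ℝ}
    (h : ∀ j ∈ τ, u j = 0) : Δ.reduce τ u = u := by
  ext k
  rw [reduce_apply, Finset.sum_eq_zero fun j hj => by rw [h j hj, zero_mul], sub_zero]

/-- The difference between a piecewise linear function and its reduction is linear. -/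
theorem exists_sub_reduce_eq (Δ : SimplicialFan ι V) (τ : Finset ι) (u : ι → ℝ) :
    ∃ l : Module.Dual ℝ V, u = Δ.reduce τ u + fun k => l (Δ.gen k) :=
  ⟨∑ j ∈ τ, u j • Δ.coordinate τ j, by ext k; simp [reduce_apply]⟩

theorem coneMonomial_eq_prod (σ : Finset ι) :
    (coneMonomial σ : MvPolynomial ι ℝ) = (σ.toList.map X).prod :=
  (Finset.prod_map_toList σ X).symm

variable [Fintype ι]

/-- The constant weight `1` on the `d`-dimensional cones is balanced: for every cone `τ` of
dimension `d - 1` the sum of the generators in the link of `τ` lies in the span of `τ`. This is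
expressed through the linear functions that vanish on `τ`. -/
def IsBalanced (Δ : SimplicialFan ι V) (d : ℕ) : Prop :=
  ∀ τ ∈ Δ.cones, τ.card + 1 = d → ∀ l : Module.Dual ℝ V, (∀ j ∈ τ, l (Δ.gen j) = 0) →
    ∑ k ∈ Δ.link τ, l (Δ.gen k) = 0

/-- The degree of `∂_τ u₁ ⋯ u_n` for a cone `τ` of dimension `d - n` and piecewise linear functions
`u₁, …, u_n`: the first factor is replaced by a combination of rays in the link of `τ`. -/
def wordDegree (Δ : SimplicialFan ι V) : List (ι → ℝ) → Finset ι → ℝ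
  | [], _ => 1
  | u :: L, τ => ∑ k ∈ Δ.link τ, Δ.reduce τ u k * wordDegree Δ L (insert k τ)

theorem wordDegree_cons (Δ : SimplicialFan ι V) (u : ι → ℝ) (L : List (ι → ℝ)) (τ : Finset ι) :
    Δ.wordDegree (u :: L) τ =
      ∑ k ∈ Δ.link τ, Δ.reduce τ u k * Δ.wordDegree L (insert k τ) := rfl

theorem wordDegree_add_cons (Δ : SimplicialFan ι V) (u v : ι → ℝ) (L : List (ι → ℝ))
    (τ : Finset ι) :
    Δ.wordDegree ((u + v) :: L) τ = Δ.wordDegree (u :: L) τ + Δ.wordDegree (v :: L) τ := by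
  simp only [wordDegree_cons, map_add, Pi.add_apply, add_mul, Finset.sum_add_distrib]

theorem wordDegree_sum_smul_cons (Δ : SimplicialFan ι V) (c : ι → ℝ) (u : ι → ι → ℝ)
    (L : List (ι → ℝ)) (τ : Finset ι) :
    Δ.wordDegree ((∑ j, c j • u j) :: L) τ = ∑ j, c j * Δ.wordDegree (u j :: L) τ := by
  simp only [wordDegree_cons, map_sum, map_smul, Finset.sum_apply, Pi.smul_apply, smul_eq_mul,
    Finset.sum_mul, Finset.mul_sum, mul_assoc]
  exact Finset.sum_comm

/-- If linear functions have degree zero on the larger cones, then the first two factors may be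
exchanged: after reducing both factors along `τ`, the degree is a visibly symmetric expression. -/
theorem wordDegree_swap_of_linear {Δ : SimplicialFan ι V} {τ : Finset ι} (hτ : τ ∈ Δ.cones)
    {L : List (ι → ℝ)}
    (h : ∀ k ∈ Δ.link τ, ∀ l : Module.Dual ℝ V,
      Δ.wordDegree ((fun m => l (Δ.gen m)) :: L) (insert k τ) = 0) (u v : ι → ℝ) :
    Δ.wordDegree (u :: v :: L) τ = Δ.wordDegree (v :: u :: L) τ := by
  have key : ∀ u v : ι → ℝ, Δ.wordDegree (u :: v :: L) τ =
      (∑ k ∈ Δ.link τ, ∑ m ∈ Δ.link (insert k τ), Δ.reduce τ u k * Δ.reduce τ v m *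
        Δ.wordDegree L (insert m (insert k τ))) -
      ∑ k ∈ Δ.link τ, Δ.reduce τ u k * Δ.reduce τ v k * ∑ m ∈ Δ.link (insert k τ),
        Δ.coordinate (insert k τ) k (Δ.gen m) * Δ.wordDegree L (insert m (insert k τ)) := by
    intro u v
    rw [wordDegree_cons, ← Finset.sum_sub_distrib]
    refine Finset.sum_congr rfl fun k hk => ?_
    obtain ⟨l, hl⟩ := Δ.exists_sub_reduce_eq τ v
    conv_lhs => rw [hl]
    rw [wordDegree_add_cons, h k hk, add_zero, wordDegree_cons]
    have hred : ∀ m, Δ.reduce (insert k τ) (Δ.reduce τ v) m =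
        Δ.reduce τ v m - Δ.reduce τ v k * Δ.coordinate (insert k τ) k (Δ.gen m) := by
      intro m
      rw [reduce_apply, Finset.sum_eq_single_of_mem k (Finset.mem_insert_self k τ)]
      intro j hj hjk
      rw [reduce_apply_of_mem hτ v (Finset.mem_of_mem_insert_of_ne hj hjk), zero_mul]
    simp only [hred, sub_mul, Finset.sum_sub_distrib, mul_sub, Finset.mul_sum, mul_assoc]
  rw [key u v, key v u]
  congr 1
  · rw [Finset.sum_comm' (t' := Δ.link τ) (s' := fun m => Δ.link (insert m τ))]
    · refine Finset.sum_congr rfl fun m _ => Finset.sum_congr rfl fun k _ => ?_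
      rw [Finset.insert_comm]
      ring
    · have aux : ∀ k m, k ∈ Δ.link τ ∧ m ∈ Δ.link (insert k τ) →
          m ∈ Δ.link τ ∧ k ∈ Δ.link (insert m τ) := by
        simp only [mem_link, Finset.mem_insert, not_or]
        rintro k m ⟨⟨hk, hkτ⟩, ⟨hmk, hm⟩, hmkτ⟩
        refine ⟨⟨hm, Δ.face_mem _ hmkτ _ ?_⟩, ⟨Ne.symm hmk, hk⟩, by rwa [Finset.insert_comm]⟩
        exact Finset.insert_subset_insert _ (Finset.subset_insert _ _)
      exact fun k m => ⟨fun h => (aux k m h).symm, fun h => aux m k h.symm⟩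
  · refine Finset.sum_congr rfl fun k _ => ?_
    rw [mul_comm (Δ.reduce τ u k)]

variable {Δ : SimplicialFan ι V} {d : ℕ}

/-- By induction on the number of factors, linear functions have degree zero: a second factor is
moved to the front, where it only contributes cones of larger dimension. -/
theorem IsBalanced.wordDegree_linear_cons (hΔ : Δ.IsBalanced d) (L : List (ι → ℝ)) :
    ∀ τ ∈ Δ.cones, τ.card + L.length + 1 = d → ∀ l : Module.Dual ℝ V,
      Δ.wordDegree ((fun m => l (Δ.gen m)) :: L) τ = 0 := by
  induction L with
  | nil =>
    intro τ hτ hc l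
    have h := hΔ τ hτ (by simpa using hc) (l - ∑ j ∈ τ, l (Δ.gen j) • Δ.coordinate τ j) (by
      intro k hk
      have := reduce_apply_of_mem hτ (fun m => l (Δ.gen m)) hk
      simpa [reduce_apply] using this)
    rw [← h]
    simp [wordDegree, reduce_apply]
  | cons u L ih =>
    intro τ hτ hc l
    have h : ∀ k ∈ Δ.link τ, ∀ l : Module.Dual ℝ V,
        Δ.wordDegree ((fun m => l (Δ.gen m)) :: L) (insert k τ) = 0 := by
      intro k hk l
      have hk' := mem_link.1 hk
      refine ih _ hk'.2 ?_ l
      rw [Finset.card_insert_of_notMem hk'.1]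
      simp only [List.length_cons] at hc
      omega
    rw [wordDegree_swap_of_linear hτ h, wordDegree_cons]
    exact Finset.sum_eq_zero fun k hk => by rw [h k hk, mul_zero]

theorem IsBalanced.wordDegree_perm (hΔ : Δ.IsBalanced d) {L L' : List (ι → ℝ)}
    (hL : L.Perm L') : ∀ τ ∈ Δ.cones, τ.card + L.length = d →
      Δ.wordDegree L τ = Δ.wordDegree L' τ := by
  induction hL with
  | nil => exact fun _ _ _ => rfl
  | cons u _ ih =>
    intro τ hτ hc
    rw [wordDegree_cons, wordDegree_cons]
    refine Finset.sum_congr rfl fun k hk => ?_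
    have hk' := mem_link.1 hk
    rw [ih _ hk'.2]
    rw [Finset.card_insert_of_notMem hk'.1]
    simp only [List.length_cons] at hc
    omega
  | swap u v L =>
    intro τ hτ hc
    refine wordDegree_swap_of_linear hτ (fun k hk l => ?_) v u
    have hk' := mem_link.1 hk
    refine hΔ.wordDegree_linear_cons L _ hk'.2 ?_ l
    rw [Finset.card_insert_of_notMem hk'.1]
    simp only [List.length_cons] at hc
    omega
  | trans h₁ _ ih₁ ih₂ =>
    intro τ hτ hc
    rw [ih₁ τ hτ hc, ih₂ τ hτ (h₁.length_eq ▸ hc)]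

/-- The first factor `∂_j` with `j ∉ τ` enlarges the cone. -/
theorem wordDegree_single_cons (L : List (ι → ℝ)) {τ : Finset ι} {j : ι} (hj : j ∉ τ) :
    Δ.wordDegree (Pi.single j 1 :: L) τ =
      if j ∈ Δ.link τ then Δ.wordDegree L (insert j τ) else 0 := by
  have : Δ.reduce τ (Pi.single j 1) = Pi.single j 1 :=
    reduce_eq_self fun k hk => Pi.single_eq_of_ne (fun h : k = j => hj (h ▸ hk)) 1
  simp [wordDegree_cons, this, Pi.single_apply]

theorem wordDegree_eq_zero (L : List ι) : ∀ τ ∈ Δ.cones, τ ∪ L.toFinset ∉ Δ.cones →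
    Δ.wordDegree (L.map fun j => Pi.single j 1) τ = 0 := by
  induction L with
  | nil => exact fun τ hτ h => absurd hτ (by simpa using h)
  | cons j L ih =>
    intro τ hτ h
    rw [List.toFinset_cons, Finset.union_insert] at h
    rw [List.map_cons]
    have hins : ∀ k, τ ∪ L.toFinset ∉ Δ.cones → insert k τ ∪ L.toFinset ∉ Δ.cones :=
      fun k hn hk => hn (Δ.face_mem _ hk _
        (Finset.union_subset_union_left (Finset.subset_insert _ _)))
    by_cases hj : j ∈ τ
    · rw [Finset.insert_eq_self.2 (Finset.mem_union_left _ hj)] at h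
      exact Finset.sum_eq_zero fun k hk => by
        rw [ih _ (mem_link.1 hk).2 (hins k h), mul_zero]
    · rw [wordDegree_single_cons _ hj]
      split_ifs with hl
      · exact ih _ (mem_link.1 hl).2 (by rwa [Finset.insert_union])
      · rfl

theorem wordDegree_eq_one (L : List ι) : ∀ τ : Finset ι, L.Nodup → (∀ j ∈ L, j ∉ τ) →
    τ ∪ L.toFinset ∈ Δ.cones → Δ.wordDegree (L.map fun j => Pi.single j 1) τ = 1 := by
  induction L with
  | nil => exact fun _ _ _ _ => rfl
  | cons j L ih =>
    intro τ hnd hd h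
    rw [List.toFinset_cons, Finset.union_insert, ← Finset.insert_union] at h
    rw [List.nodup_cons] at hnd
    have hj : j ∉ τ := hd j (by simp)
    rw [List.map_cons, wordDegree_single_cons _ hj, if_pos, ih _ hnd.2 _ h]
    · intro k hk hk'
      rcases Finset.mem_insert.1 hk' with rfl | hk'
      · exact hnd.1 hk
      · exact hd k (by simp [hk]) hk'
    · exact mem_link.2 ⟨hj, Δ.face_mem _ h _ Finset.subset_union_left⟩

/-- A linear functional on the polynomial ring that induces a degree map on `CH^d`. -/
structure IsDegreeFunctional (Δ : SimplicialFan ι V) (d : ℕ) (φ : MvPolynomial ι ℝ →ₗ[ℝ] ℝ) :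
    Prop where
  map_chowIdeal : ∀ f ∈ Δ.chowIdeal, φ f = 0
  map_cone : ∀ σ ∈ Δ.cones, σ.card = d → φ (coneMonomial σ) = 1

/-- The linear functional with value `wordDegree` on the monomials of degree `d` and `0` on all
other monomials. -/
def degreeFunctional (Δ : SimplicialFan ι V) (d : ℕ) : MvPolynomial ι ℝ →ₗ[ℝ] ℝ :=
  (basisMonomials ι ℝ).constr ℝ fun a =>
    if Multiset.card a.toMultiset = d then
      Δ.wordDegree (a.toMultiset.toList.map fun j => Pi.single j 1) ∅
    else 0

theorem IsBalanced.degreeFunctional_prod (hΔ : Δ.IsBalanced d) (L : List ι) :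
    Δ.degreeFunctional d (L.map X).prod =
      if L.length = d then Δ.wordDegree (L.map fun j => Pi.single j 1) ∅ else 0 := by
  have h1 : (L.map X).prod = basisMonomials ι ℝ (Multiset.toFinsupp (L : Multiset ι)) := by
    rw [coe_basisMonomials]
    dsimp only
    rw [monomial_one_eq_prod, Multiset.toFinsupp_toMultiset,
      Multiset.map_coe, Multiset.prod_coe]
  rw [h1, degreeFunctional, Module.Basis.constr_basis, Multiset.toFinsupp_toMultiset,
    Multiset.coe_card]
  split_ifs with h
  · refine hΔ.wordDegree_perm (List.Perm.map _ ?_) ∅ Δ.zero_mem ?_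
    · exact Multiset.coe_eq_coe.1 (Multiset.coe_toList _)
    · simpa using h
  · rfl

/-- If the constant weight `1` is balanced, then it defines a degree map. -/
theorem IsBalanced.isDegreeFunctional (hΔ : Δ.IsBalanced d) :
    Δ.IsDegreeFunctional d (Δ.degreeFunctional d) where
  map_cone σ hσ hc := by
    rw [coneMonomial_eq_prod, hΔ.degreeFunctional_prod, if_pos (by simpa using hc),
      wordDegree_eq_one _ _ σ.nodup_toList (by simp) (by simpa using hσ)]
  map_chowIdeal := by
    let K : Ideal (MvPolynomial ι ℝ) :=
      { carrier := {f | ∀ g, Δ.degreeFunctional d (g * f) = 0}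
        zero_mem' := fun g => by simp
        add_mem' := fun ha hb g => by rw [mul_add, map_add, ha g, hb g, add_zero]
        smul_mem' := fun c f hf g => by rw [smul_eq_mul, ← mul_assoc]; exact hf _ }
    -- It is enough to test membership in `K` on products with monomials.
    have hK : ∀ f, (∀ L : List ι, Δ.degreeFunctional d ((L.map X).prod * f) = 0) → f ∈ K := by
      intro f hf g
      induction g using MvPolynomial.induction_on' with
      | monomial a b =>
        have hm : monomial a b = b • ((a.toMultiset.toList.map X).prod : MvPolynomial ι ℝ) := by
          rw [← Multiset.prod_coe, ← Multiset.map_coe, Multiset.coe_toList,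
            ← monomial_one_eq_prod, smul_monomial, smul_eq_mul, mul_one]
        rw [hm, smul_mul_assoc, map_smul, hf, smul_zero]
      | add p q hp hq => rw [add_mul, map_add, hp, hq, add_zero]
    have hle : Δ.chowIdeal ≤ K := by
      refine sup_le (Ideal.span_le.2 ?_) (Ideal.span_le.2 ?_)
      · rintro _ ⟨σ, hσ, rfl⟩
        refine hK _ fun L => ?_
        rw [coneMonomial_eq_prod, ← List.prod_append, ← List.map_append, hΔ.degreeFunctional_prod]
        split_ifs
        · refine wordDegree_eq_zero _ _ Δ.zero_mem fun h => hσ (Δ.face_mem _ h _ ?_)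
          intro j hj
          simp [hj]
        · rfl
      · rintro _ ⟨l, rfl⟩
        refine hK _ fun L => ?_
        have h1 : (L.map X).prod * Δ.linearForm l =
            ∑ j, l (Δ.gen j) • (((j :: L).map X).prod : MvPolynomial ι ℝ) := by
          rw [linearForm, Finset.mul_sum]
          refine Finset.sum_congr rfl fun j _ => ?_
          rw [List.map_cons, List.prod_cons, smul_eq_C_mul]
          ring
        simp only [h1, map_sum, map_smul, hΔ.degreeFunctional_prod, List.length_cons, smul_eq_mul]
        by_cases hd : L.length + 1 = d
        · simp only [if_pos hd, List.map_cons]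
          rw [← wordDegree_sum_smul_cons]
          have h2 : ∑ j, l (Δ.gen j) • (Pi.single j 1 : ι → ℝ) = fun m => l (Δ.gen m) := by
            ext m
            simp [Finset.sum_apply, Pi.single_apply]
          rw [h2]
          exact hΔ.wordDegree_linear_cons _ _ Δ.zero_mem (by simpa using hd) l
        · simp [if_neg hd]
    intro f hf
    simpa using hle hf 1

/-! ### Degree functionals and mixed volumes -/

theorem IsDegreeFunctional.map_eq {φ : MvPolynomial ι ℝ →ₗ[ℝ] ℝ} (hφ : Δ.IsDegreeFunctional d φ)
    {f g : MvPolynomial ι ℝ} (h : Δ.toChow f = Δ.toChow g) : φ f = φ g := by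
  rw [← sub_eq_zero, ← map_sub]
  exact hφ.map_chowIdeal _ (toChow_eq_iff.1 h)

theorem IsDegreeFunctional.exists_isDegreeMap {φ : MvPolynomial ι ℝ →ₗ[ℝ] ℝ}
    (hφ : Δ.IsDegreeFunctional d φ) :
    ∃ ψ : Δ.chowDeg d →ₗ[ℝ] ℝ, Δ.IsDegreeMap d ψ ∧
      ∀ f (hf : Δ.toChow f ∈ Δ.chowDeg d), ψ ⟨Δ.toChow f, hf⟩ = φ f := by
  obtain ⟨s, hs⟩ := Δ.toChow.toLinearMap.exists_rightInverse_of_surjective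
    (LinearMap.range_eq_top.2 Ideal.Quotient.mk_surjective)
  have h : ∀ f, φ (s (Δ.toChow f)) = φ f := fun f =>
    hφ.map_eq (LinearMap.congr_fun hs (Δ.toChow f))
  refine ⟨φ ∘ₗ s ∘ₗ (Δ.chowDeg d).subtype, fun σ hσ hc => ?_, fun f _ => h f⟩
  exact (h _).trans (hφ.map_cone σ hσ hc)

theorem IsDegreeFunctional.existsUnique {φ : MvPolynomial ι ℝ →ₗ[ℝ] ℝ}
    (hφ : Δ.IsDegreeFunctional d φ) : ∃! ψ, Δ.IsDegreeMap d ψ := by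
  obtain ⟨ψ, hψ, -⟩ := hφ.exists_isDegreeMap
  exact ⟨ψ, hψ, fun _ h => h.unique hψ⟩

theorem IsDegreeFunctional.degreeMap_apply {φ : MvPolynomial ι ℝ →ₗ[ℝ] ℝ}
    (hφ : Δ.IsDegreeFunctional d φ) (f : MvPolynomial ι ℝ) (hf : Δ.toChow f ∈ Δ.chowDeg d) :
    Δ.degreeMap d ⟨Δ.toChow f, hf⟩ = φ f := by
  obtain ⟨ψ, hψ, h⟩ := hφ.exists_isDegreeMap
  have hex : ∃ φ, Δ.IsDegreeMap d φ := ⟨ψ, hψ⟩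
  rw [degreeMap, dif_pos hex, hex.choose_spec.unique hψ, h]

/-- The value of the mixed volume at a piecewise linear function `t` is its `d`-fold
self-intersection number divided by `d!`. -/
theorem IsDegreeFunctional.eval_mixedVolume {φ : MvPolynomial ι ℝ →ₗ[ℝ] ℝ}
    (hφ : Δ.IsDegreeFunctional d φ) (t : ι → ℝ) :
    eval t (Δ.mixedVolume d) = φ ((∑ j, C (t j) * X j) ^ d) / d.factorial := by
  rw [mixedVolume, map_sum, Finset.sum_pow_eq_sum_piAntidiag, map_sum, Finset.sum_div]
  have h1 : ∀ a : {a // a ∈ (Finset.univ : Finset ι).finsuppAntidiag d},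
      eval t (monomial a.1 (Δ.degreeMap d ⟨Δ.toChow (monomial a.1 1),
        toChow_mem (monomial_isHomogeneous_of_mem a.2)⟩ / ∏ j, ((a.1 j).factorial : ℝ))) =
      φ (monomial a.1 1) / (∏ j, ((a.1 j).factorial : ℝ)) * ∏ j, t j ^ a.1 j := by
    intro a
    rw [hφ.degreeMap_apply, eval_monomial, Finsupp.prod_fintype _ _ (by simp)]
  rw [Finset.sum_congr rfl fun a _ => h1 a, Finset.sum_attach _ fun a : ι →₀ ℕ =>
    φ (monomial a 1) / (∏ j, ((a j).factorial : ℝ)) * ∏ j, t j ^ a j]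
  refine Finset.sum_nbij' (fun a => ⇑a) Finsupp.equivFunOnFinite.symm ?_ ?_ (by simp) (by simp) ?_
  · intro a ha
    simpa using (Finset.mem_finsuppAntidiag.1 ha).1
  · intro a ha
    simpa [Finset.mem_finsuppAntidiag] using (Finset.mem_piAntidiag.1 ha).1
  · intro a ha
    have hsum : ∑ j, a j = d := (Finset.mem_finsuppAntidiag.1 ha).1
    have hspec := Nat.multinomial_spec Finset.univ a
    rw [hsum] at hspec
    have hm : (Nat.multinomial Finset.univ a : MvPolynomial ι ℝ) * ∏ j, (C (t j) * X j) ^ a j =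
        ((Nat.multinomial Finset.univ a : ℝ) * ∏ j, t j ^ a j) • monomial a 1 := by
      have h2 : (monomial a (1 : ℝ)) = ∏ j, X j ^ a j := by
        rw [monomial_eq, C_1, one_mul, Finsupp.prod_fintype _ _ (by simp)]
      rw [h2, smul_eq_C_mul, map_mul, map_prod, map_natCast, mul_assoc, ← Finset.prod_mul_distrib]
      simp only [mul_pow, C_pow]
    have hne : (∏ j, ((a j).factorial : ℝ)) ≠ 0 :=
      Finset.prod_ne_zero_iff.2 fun j _ => by positivity
    have hne' : (Nat.multinomial Finset.univ a : ℝ) ≠ 0 :=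
      Nat.cast_ne_zero.2 (Nat.multinomial_pos _ _).ne'
    rw [hm, map_smul, smul_eq_mul, ← hspec]
    push_cast
    field_simp

end Existence

end SimplicialFan

namespace Matroid

variable {α : Type*}

/-! ### Chains of flats and the Bergman fan -/

theorem isFlat_empty (N : Matroid α) [N.Loopless] : N.IsFlat ∅ := by
  rw [isFlat_iff_closure_eq]
  exact N.loops_eq_empty

theorem IsFlat.eRk_lt_eRk {N : Matroid α} [N.Finite] {F G : Set α} (hF : N.IsFlat F)
    (hG : N.IsFlat G) (h : F ⊂ G) : N.eRk F < N.eRk G := by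
  by_contra! hle
  have hfin : N.IsRkFinite F := N.isRkFinite_set F
  have := hfin.closure_eq_closure_of_subset_of_eRk_ge_eRk h.subset hle
  rw [hF.closure, hG.closure] at this
  exact h.ne this

/-- The ranks of the members of a chain of nontrivial flats are distinct and lie strictly between
the ranks of `∅` and of the ground set. -/
theorem card_le_of_isChain {N : Matroid α} [N.Finite] [N.Loopless] {d : ℕ}
    (hd : N.eRank ≤ d + 1) {T : Finset N.NontrivialFlat}
    (hT : IsChain (· ≤ ·) (T : Set N.NontrivialFlat)) : T.card ≤ d := by
  have hcast : ∀ F : Set α, ((N.eRk F).toNat : ℕ∞) = N.eRk F := fun F =>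
    ENat.natCast_toNat (N.isRkFinite_set F).eRk_lt_top.ne
  have hlt : ∀ F G : Set α, N.IsFlat F → N.IsFlat G → F ⊂ G →
      (N.eRk F).toNat < (N.eRk G).toNat := by
    intro F G hF hG h
    have := hF.eRk_lt_eRk hG h
    rw [← hcast F, ← hcast G] at this
    exact_mod_cast this
  have hle : (N.eRk N.E).toNat ≤ d + 1 := by
    rw [← eRank_def] at *
    have := hcast N.E
    rw [← eRank_def] at this
    rw [← this] at hd
    exact_mod_cast hd
  have hmaps : ∀ F ∈ T, (N.eRk F).toNat ∈ Finset.Icc 1 d := by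
    intro F _
    have h1 := hlt ∅ F N.isFlat_empty F.2.1 (Set.empty_ssubset.2 F.2.2.1)
    have h2 := hlt F N.E F.2.1 N.ground_isFlat (F.2.1.subset_ground.ssubset_of_ne F.2.2.2)
    rw [Finset.mem_Icc]
    omega
  have hinj : Set.InjOn (fun F : N.NontrivialFlat => (N.eRk F).toNat) T := by
    intro F hF G hG h
    by_contra hne
    have hne' : (F : Set α) ≠ G := fun h => hne (Subtype.ext h)
    rcases hT.total hF hG with h' | h'
    · exact (hlt F G F.2.1 G.2.1 (LE.le.ssubset_of_ne h' hne')).ne h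
    · exact (hlt G F G.2.1 F.2.1 (LE.le.ssubset_of_ne h' hne'.symm)).ne h.symm
  simpa using Finset.card_le_card_of_injOn _ hmaps hinj

theorem IsFlat.closure_insert_subset {N : Matroid α} {A B : Set α} {x : α} (hB : N.IsFlat B)
    (hAB : A ⊆ B) (hx : x ∈ B) : N.closure (insert x A) ⊆ B := by
  rw [← hB.closure]
  exact N.closure_subset_closure (Set.insert_subset hx hAB)

/-- If there are flats strictly between `A` and `B`, but no two of them are nested, then they
partition `B \ A`. -/
theorem exists_unique_flat_between {N : Matroid α} {A B : Set α} (hA : N.IsFlat A)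
    (hB : N.IsFlat B) (hex : ∃ H, N.IsFlat H ∧ A ⊂ H ∧ H ⊂ B)
    (hgap : ∀ H H', N.IsFlat H → N.IsFlat H' → A ⊂ H → H ⊂ H' → ¬ H' ⊂ B)
    {x : α} (hxB : x ∈ B) (hxA : x ∉ A) :
    ∃ H, (N.IsFlat H ∧ A ⊂ H ∧ H ⊂ B ∧ x ∈ H) ∧
      ∀ H', N.IsFlat H' → A ⊂ H' → H' ⊂ B → x ∈ H' → H' = H := by
  obtain ⟨H₀, hH₀, hAH₀, hH₀B⟩ := hex
  have hxE : x ∈ N.E := hB.subset_ground hxB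
  have hsub : insert x A ⊆ N.closure (insert x A) :=
    N.subset_closure _ (Set.insert_subset hxE hA.subset_ground)
  have hx : x ∈ N.closure (insert x A) := hsub (Set.mem_insert _ _)
  have hAs : A ⊂ N.closure (insert x A) :=
    ⟨(Set.subset_insert _ _).trans hsub, fun h => hxA (h hx)⟩
  have hne : N.closure (insert x A) ≠ B := by
    intro h
    obtain ⟨y, hy, hyA⟩ := Set.exists_of_ssubset hAH₀
    have hycl : y ∈ N.closure (insert x A) \ N.closure A :=
      ⟨h ▸ hH₀B.subset hy, by rwa [hA.closure]⟩
    have h2 : N.closure (insert y A) = B := by rw [N.closure_insert_congr hycl, h]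
    exact hH₀B.not_subset (h2 ▸ hH₀.closure_insert_subset hAH₀.subset hy)
  refine ⟨N.closure (insert x A), ⟨N.isFlat_closure _, hAs,
    (hB.closure_insert_subset (hAH₀.subset.trans hH₀B.subset) hxB).ssubset_of_ne hne, hx⟩, ?_⟩
  intro H' hH' hAH' hH'B hxH'
  by_contra hne'
  exact hgap _ H' (N.isFlat_closure _) hH' hAs
    ((hH'.closure_insert_subset hAH'.subset hxH').ssubset_of_ne (Ne.symm hne')) hH'B

theorem mem_cones_bergmanFan {N : Matroid α} {τ : Finset N.NontrivialFlat} :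
    τ ∈ N.bergmanFan.cones ↔ IsChain (· ≤ ·) (τ : Set N.NontrivialFlat) := Iff.rfl

theorem mem_link_bergmanFan {N : Matroid α} [N.Finite] {τ : Finset N.NontrivialFlat}
    (hτ : IsChain (· ≤ ·) (τ : Set N.NontrivialFlat)) {H : N.NontrivialFlat} :
    H ∈ N.bergmanFan.link τ ↔ H ∉ τ ∧ ∀ F ∈ τ, F ≤ H ∨ H ≤ F := by
  classical
  rw [SimplicialFan.mem_link]
  refine and_congr_right fun hH => ?_
  rw [mem_cones_bergmanFan, Finset.coe_insert]
  constructor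
  · intro h F hF
    exact h.total (Set.mem_insert_of_mem _ hF) (Set.mem_insert _ _)
  · intro h
    exact hτ.insert fun F hF _ => (h F hF).symm

/-- A chain of `d - 1` nontrivial flats of a matroid of rank at most `d + 1` that can be extended
at all has a single gap, and the flats that extend it are those in the gap. -/
theorem exists_gap {N : Matroid α} [N.Finite] [N.Loopless] {d : ℕ} (hd : N.eRank ≤ d + 1)
    {τ : Finset N.NontrivialFlat} (hτ : IsChain (· ≤ ·) (τ : Set N.NontrivialFlat))
    (hc : τ.card + 1 = d) (hne : (N.bergmanFan.link τ).Nonempty) :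
    ∃ A B : Set α, (A = ∅ ∨ ∃ F ∈ τ, (F : Set α) = A) ∧ (B = N.E ∨ ∃ F ∈ τ, (F : Set α) = B) ∧
      (∀ H : N.NontrivialFlat, H ∈ N.bergmanFan.link τ ↔ A ⊂ H ∧ (H : Set α) ⊂ B) ∧
      ∀ x ∈ B, x ∉ A → ∃! H, H ∈ N.bergmanFan.link τ ∧ x ∈ (H : Set α) := by
  classical
  obtain ⟨H₀, hH₀⟩ := hne
  have hH₀' := (mem_link_bergmanFan hτ).1 hH₀
  have hss : ∀ {F G : N.NontrivialFlat}, F ≤ G → F ≠ G → (F : Set α) ⊂ G := fun h hn =>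
    LE.le.ssubset_of_ne h fun h' => hn (Subtype.ext h')
  -- `A` is the largest member below `H₀`, and `B` the smallest member above it.
  obtain ⟨A, hA, hAm, hAH, hAmax⟩ : ∃ A, N.IsFlat A ∧ (A = ∅ ∨ ∃ F ∈ τ, (F : Set α) = A) ∧
      A ⊂ H₀ ∧ ∀ F ∈ τ, F ≤ H₀ → (F : Set α) ⊆ A := by
    by_cases h : (τ.filter (· ≤ H₀)).Nonempty
    · obtain ⟨F, hF⟩ := Finset.exists_maximal h
      have hF' := Finset.mem_filter.1 hF.1
      refine ⟨F, F.2.1, Or.inr ⟨F, hF'.1, rfl⟩, hss hF'.2 fun h => hH₀'.1 (h ▸ hF'.1), ?_⟩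
      intro G hG hGH
      rcases hτ.total hG hF'.1 with h' | h'
      · exact h'
      · exact hF.2 (Finset.mem_filter.2 ⟨hG, hGH⟩) h'
    · exact ⟨∅, N.isFlat_empty, Or.inl rfl, Set.empty_ssubset.2 H₀.2.2.1, fun F hF hFH =>
        absurd ⟨F, Finset.mem_filter.2 ⟨hF, hFH⟩⟩ h⟩
  obtain ⟨B, hB, hBm, hHB, hBmin⟩ : ∃ B, N.IsFlat B ∧ (B = N.E ∨ ∃ F ∈ τ, (F : Set α) = B) ∧
      (H₀ : Set α) ⊂ B ∧ ∀ F ∈ τ, H₀ ≤ F → B ⊆ F := by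
    by_cases h : (τ.filter (H₀ ≤ ·)).Nonempty
    · obtain ⟨F, hF⟩ := Finset.exists_minimal h
      have hF' := Finset.mem_filter.1 hF.1
      refine ⟨F, F.2.1, Or.inr ⟨F, hF'.1, rfl⟩, hss hF'.2 fun h => hH₀'.1 (h ▸ hF'.1), ?_⟩
      intro G hG hGH
      rcases hτ.total hG hF'.1 with h' | h'
      · exact hF.2 (Finset.mem_filter.2 ⟨hG, hGH⟩) h'
      · exact h'
    · exact ⟨N.E, N.ground_isFlat, Or.inl rfl,
        H₀.2.1.subset_ground.ssubset_of_ne H₀.2.2.2, fun F hF hFH =>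
        absurd ⟨F, Finset.mem_filter.2 ⟨hF, hFH⟩⟩ h⟩
  have hdich : ∀ F ∈ τ, (F : Set α) ⊆ A ∨ B ⊆ F := fun F hF =>
    (hH₀'.2 F hF).imp (hAmax F hF) (hBmin F hF)
  have hnt : ∀ H, N.IsFlat H → A ⊂ H → H ⊂ B → N.IsNontrivialFlat H := fun H hH h1 h2 =>
    ⟨hH, (Set.empty_subset A).trans_ssubset h1 |> Set.empty_ssubset.1,
      fun h => h2.not_subset (h ▸ hB.subset_ground)⟩
  have hlink : ∀ H : N.NontrivialFlat, A ⊂ H → (H : Set α) ⊂ B → H ∈ N.bergmanFan.link τ := by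
    intro H h1 h2
    refine (mem_link_bergmanFan hτ).2 ⟨fun hH => ?_, fun F hF => ?_⟩
    · rcases hdich H hH with h | h
      · exact h1.not_subset h
      · exact h2.not_subset h
    · exact (hdich F hF).imp (fun h => h.trans h1.subset) fun h => h2.subset.trans h
  -- Two comparable rays in the link would give a chain that is too long.
  have hlong : ∀ H ∈ N.bergmanFan.link τ, ∀ H' ∈ N.bergmanFan.link τ, H ≤ H' → H = H' := by
    intro H hH H' hH' hle
    by_contra hne
    rw [mem_link_bergmanFan hτ] at hH hH'
    have hch : IsChain (· ≤ ·)
        ((insert H (insert H' τ) : Finset N.NontrivialFlat) : Set N.NontrivialFlat) := by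
      rw [Finset.coe_insert, Finset.coe_insert]
      refine (hτ.insert fun F hF _ => (hH'.2 F hF).symm).insert fun F hF _ => ?_
      rcases hF with rfl | hF
      · exact Or.inl hle
      · exact (hH.2 F hF).symm
    have := card_le_of_isChain hd hch
    rw [Finset.card_insert_of_notMem (by simp [hne, hH.1]), Finset.card_insert_of_notMem hH'.1]
      at this
    omega
  have hiff : ∀ H : N.NontrivialFlat, H ∈ N.bergmanFan.link τ ↔ A ⊂ H ∧ (H : Set α) ⊂ B := by
    refine fun H => ⟨fun hH => ?_, fun h => hlink H h.1 h.2⟩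
    have hH' := (mem_link_bergmanFan hτ).1 hH
    constructor
    · rcases hAm with rfl | ⟨F, hF, rfl⟩
      · exact Set.empty_ssubset.2 H.2.2.1
      · rcases hH'.2 F hF with h | h
        · exact hss h fun h => hH'.1 (h ▸ hF)
        · have := hlong H hH H₀ hH₀ (h.trans hAH.subset)
          exact this ▸ hAH
    · rcases hBm with rfl | ⟨F, hF, rfl⟩
      · exact H.2.1.subset_ground.ssubset_of_ne H.2.2.2
      · rcases hH'.2 F hF with h | h
        · have := hlong H₀ hH₀ H hH (le_trans (α := N.NontrivialFlat) hHB.subset h)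
          exact this ▸ hHB
        · exact hss h fun h => hH'.1 (h ▸ hF)
  refine ⟨A, B, hAm, hBm, hiff, fun x hxB hxA => ?_⟩
  obtain ⟨H, ⟨hH, h1, h2, hxH⟩, huniq⟩ := exists_unique_flat_between hA hB
    ⟨H₀, H₀.2.1, hAH, hHB⟩ (fun H H' hH hH' h1 h2 h3 => by
      have e := hlong ⟨H, hnt H hH h1 (h2.trans h3)⟩ (hlink _ h1 (h2.trans h3))
        ⟨H', hnt H' hH' (h1.trans h2) h3⟩ (hlink _ (h1.trans h2) h3) h2.subset
      exact h2.ne (congrArg Subtype.val e)) hxB hxA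
  refine ⟨⟨H, hnt H hH h1 h2⟩, ⟨hlink _ h1 h2, hxH⟩, fun H' hH' => ?_⟩
  have := (hiff H').1 hH'.1
  exact Subtype.ext (huniq H' H'.2.1 this.1 this.2 hH'.2)

theorem flatVector_empty (N : Matroid α) : N.flatVector ∅ = 0 := by
  rw [flatVector, Submodule.Quotient.mk_eq_zero]
  convert Submodule.zero_mem _
  ext x
  simp

theorem flatVector_ground (N : Matroid α) : N.flatVector N.E = 0 := by
  rw [flatVector, Submodule.Quotient.mk_eq_zero]
  convert Submodule.mem_span_singleton_self (R := ℝ) (1 : N.E → ℝ)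
  ext x
  simp

theorem mkQ_indicator (N : Matroid α) (F : Set α) :
    (Submodule.span ℝ {(1 : N.E → ℝ)}).mkQ (Set.indicator {x : N.E | (x : α) ∈ F} 1) =
      N.flatVector F := rfl

theorem bergmanFan_gen (N : Matroid α) (F : N.NontrivialFlat) :
    N.bergmanFan.gen F = N.flatVector F := rfl

/-- The constant weight `1` on the Bergman fan is balanced: the flats in the gap between `A` and `B`
partition `B \ A`, so the vectors `e_H - e_A` add up to `e_B - e_A`. -/
theorem isBalanced_bergmanFan {N : Matroid α} [N.Finite] [N.Loopless] {d : ℕ}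
    (hd : N.eRank ≤ d + 1) : N.bergmanFan.IsBalanced d := by
  intro τ hτ hc l hl
  by_cases hne : (N.bergmanFan.link τ).Nonempty
  swap
  · rw [Finset.not_nonempty_iff_eq_empty.1 hne, Finset.sum_empty]
  obtain ⟨A, B, hA, hB, hlink, hpart⟩ := exists_gap hd hτ hc hne
  have hlA : l (N.flatVector A) = 0 := by
    rcases hA with rfl | ⟨F, hF, rfl⟩
    · rw [flatVector_empty, map_zero]
    · exact hl F hF
  have hlB : l (N.flatVector B) = 0 := by
    rcases hB with rfl | ⟨F, hF, rfl⟩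
    · rw [flatVector_ground, map_zero]
    · exact hl F hF
  have hvec : ∑ H ∈ N.bergmanFan.link τ, (N.flatVector H - N.flatVector A) =
      N.flatVector B - N.flatVector A := by
    classical
    have hfun : ∑ H ∈ N.bergmanFan.link τ,
        (Set.indicator {x : N.E | (x : α) ∈ (H : Set α)} (1 : N.E → ℝ) -
          Set.indicator {x : N.E | (x : α) ∈ A} 1) =
        Set.indicator {x : N.E | (x : α) ∈ B} 1 - Set.indicator {x : N.E | (x : α) ∈ A} 1 := by
      ext x
      simp only [Finset.sum_apply, Pi.sub_apply, Set.indicator_apply, Set.mem_ofPred_eq,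
        Pi.one_apply]
      obtain ⟨H₀, hH₀⟩ := hne
      have hAB : A ⊆ B := ((hlink H₀).1 hH₀).1.subset.trans ((hlink H₀).1 hH₀).2.subset
      by_cases hxA : (x : α) ∈ A
      · rw [if_pos hxA, if_pos (hAB hxA), sub_self]
        exact Finset.sum_eq_zero fun H hH => by
          rw [if_pos (((hlink H).1 hH).1.subset hxA), sub_self]
      · by_cases hxB : (x : α) ∈ B
        · obtain ⟨H, ⟨hH, hxH⟩, huniq⟩ := hpart x hxB hxA
          rw [Finset.sum_eq_single_of_mem H hH, if_pos hxH, if_pos hxB]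
          intro H' hH' hne'
          rw [if_neg fun hx => hne' (huniq H' ⟨hH', hx⟩), if_neg hxA, sub_self]
        · rw [if_neg hxA, if_neg hxB, sub_self]
          exact Finset.sum_eq_zero fun H hH => by
            rw [if_neg fun hx => hxB (((hlink H).1 hH).2.subset hx), sub_self]
    have := congrArg (Submodule.span ℝ {(1 : N.E → ℝ)}).mkQ hfun
    simpa only [map_sum, map_sub, mkQ_indicator] using this
  have := congrArg l hvec
  simpa [hlA, hlB, bergmanFan_gen] using this

/-! ### The flats of the deletion and the rays and cones of the contracted fan -/

section Deletion

variable {M : Matroid α} {i : α}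

theorem notMem_of_nontrivialFlat_delete (G : (M ＼ {i}).NontrivialFlat) : i ∉ (G : Set α) :=
  fun h => (G.2.1.subset_ground h).2 rfl

theorem subset_ground_of_nontrivialFlat_delete (G : (M ＼ {i}).NontrivialFlat) :
    (G : Set α) ⊆ M.E :=
  G.2.1.subset_ground.trans Set.sdiff_subset

theorem subset_closure_of_nontrivialFlat_delete (G : (M ＼ {i}).NontrivialFlat) :
    (G : Set α) ⊆ M.closure G :=
  M.subset_closure _ (subset_ground_of_nontrivialFlat_delete G)

theorem closure_sdiff_of_nontrivialFlat_delete (G : (M ＼ {i}).NontrivialFlat) :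
    M.closure G \ {i} = G := by
  have h := G.2.1.closure
  rwa [delete_closure_eq_of_disjoint M
    (Set.disjoint_singleton_right.2 (notMem_of_nontrivialFlat_delete G))] at h

theorem closure_eq_self_of_notMem (G : (M ＼ {i}).NontrivialFlat) (h : i ∉ M.closure G) :
    M.closure G = G := by
  rw [← closure_sdiff_of_nontrivialFlat_delete G, Set.sdiff_singleton_eq_self h,
    closure_closure]

theorem closure_eq_insert_of_mem (G : (M ＼ {i}).NontrivialFlat) (h : i ∈ M.closure G) :
    M.closure G = insert i (G : Set α) := by
  conv_rhs => rw [← closure_sdiff_of_nontrivialFlat_delete G, Set.insert_sdiff_self_of_mem h]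

theorem mem_closure_iff_of_ne (G : (M ＼ {i}).NontrivialFlat) {x : α} (hx : x ≠ i) :
    x ∈ M.closure G ↔ x ∈ (G : Set α) := by
  conv_rhs => rw [← closure_sdiff_of_nontrivialFlat_delete G]
  simp [hx]

theorem closure_ground_sdiff (hi : ¬ M.IsColoop i) : M.closure (M.E \ {i}) = M.E := by
  by_contra h
  exact hi (isColoop_iff_sdiff_closure.2 h)

theorem IsFlat.eq_ground_of_sdiff_subset (hi : ¬ M.IsColoop i) {F : Set α} (hF : M.IsFlat F)
    (h : M.E \ {i} ⊆ F) : F = M.E := by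
  refine hF.subset_ground.antisymm ?_
  rw [← closure_ground_sdiff hi, ← hF.closure]
  exact M.closure_subset_closure h

theorem isNontrivialFlat_delete_sdiff (hi : ¬ M.IsColoop i) {F : Set α} (hF : M.IsNontrivialFlat F)
    (hFi : F ≠ {i}) : (M ＼ {i}).IsNontrivialFlat (F \ {i}) := by
  refine ⟨?_, ?_, fun h => hF.2.2 (hF.1.eq_ground_of_sdiff_subset hi ?_)⟩
  · rw [isFlat_iff_closure_eq, delete_closure_eq, sdiff_idem]
    refine Set.Subset.antisymm (Set.sdiff_subset_sdiff_left ?_) ?_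
    · conv_rhs => rw [← hF.1.closure]
      exact M.closure_subset_closure Set.sdiff_subset
    · exact fun x hx => ⟨M.subset_closure _ (Set.sdiff_subset.trans hF.1.subset_ground) hx, hx.2⟩
  · rw [Set.nonempty_iff_ne_empty]
    intro h
    exact hFi (hF.2.1.subset_singleton_iff.1 (Set.sdiff_eq_empty.1 h))
  · rw [← delete_ground, ← h]
    exact Set.sdiff_subset

theorem isNontrivialFlat_insert (G : (M ＼ {i}).NontrivialFlat)
    (h : M.IsFlat (insert i (G : Set α))) : M.IsNontrivialFlat (insert i (G : Set α)) := by
  refine ⟨h, Set.insert_nonempty _ _, fun hE => G.2.2.2 ?_⟩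
  rw [delete_ground, ← hE, Set.insert_sdiff_self_of_notMem (notMem_of_nontrivialFlat_delete G)]

theorem closureRay_coe (G : (M ＼ {i}).NontrivialFlat) :
    (M.closureRay i G : Set α) = M.closure G := rfl

theorem closureRay_sdiff (G : (M ＼ {i}).NontrivialFlat) :
    (M.closureRay i G : Set α) \ {i} = G :=
  closure_sdiff_of_nontrivialFlat_delete G

theorem closureRay_injective : Function.Injective (M.closureRay i) := by
  intro G H h
  apply Subtype.ext
  rw [← closureRay_sdiff G, h, closureRay_sdiff]

theorem eq_closureRay (hi : ¬ M.IsColoop i) (j : M.ContractedRay i) (hj : (j : Set α) ≠ {i}) :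
    M.closureRay i ⟨j \ {i}, isNontrivialFlat_delete_sdiff hi j.2.1 hj⟩ = j := by
  apply Subtype.ext
  rw [closureRay_coe]
  by_cases hij : i ∈ (j : Set α)
  · have hle : M.closure ((j : Set α) \ {i}) ⊆ j := by
      conv_rhs => rw [← j.2.1.1.closure]
      exact M.closure_subset_closure Set.sdiff_subset
    set G : (M ＼ {i}).NontrivialFlat := ⟨j \ {i}, isNontrivialFlat_delete_sdiff hi j.2.1 hj⟩ with hG
    have hins : insert i (G : Set α) = j := Set.insert_sdiff_self_of_mem hij
    by_cases hcl : i ∈ M.closure (G : Set α)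
    · rw [closure_eq_insert_of_mem G hcl, hins]
    · -- Otherwise `j` would be the larger member of its class.
      have hGflat : M.IsFlat G := isFlat_iff_closure_eq.2 (closure_eq_self_of_notMem G hcl)
      refine absurd hins.symm (j.2.2 G ⟨⟨hGflat, G.2.2.1, fun h => ?_⟩, ?_, ?_⟩)
      · exact notMem_of_nontrivialFlat_delete G (h ▸ j.2.1.1.subset_ground hij)
      · rw [hins]
        exact j.2.1
      · intro h
        exact notMem_of_nontrivialFlat_delete G (h ▸ Set.mem_insert _ _)
  · have : (j : Set α) \ {i} = j := Set.sdiff_singleton_eq_self hij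
    change M.closure ((j : Set α) \ {i}) = j
    rw [this, j.2.1.1.closure]

theorem mem_cones_contractedFan {σ : Finset (M.ContractedRay i)} :
    σ ∈ (M.contractedFan i).cones ↔ ∃ C : Finset M.NontrivialFlat,
      IsChain (· ≤ ·) (C : Set M.NontrivialFlat) ∧ ∀ r, r ∈ σ ↔ ∃ F ∈ C, M.contractRay i F = r := by
  classical
  constructor
  · rintro ⟨C, hC, rfl⟩
    exact ⟨C, hC, fun r => by rw [Finset.mem_image]⟩
  · rintro ⟨C, hC, h⟩
    exact ⟨C, hC, by ext r; rw [h, Finset.mem_image]⟩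

theorem total_of_mem_cones {σ : Finset (M.ContractedRay i)}
    (hσ : σ ∈ (M.contractedFan i).cones) {G H : (M ＼ {i}).NontrivialFlat}
    (hG : M.closureRay i G ∈ σ) (hH : M.closureRay i H ∈ σ) : G ≤ H ∨ H ≤ G := by
  obtain ⟨C, hC, h⟩ := mem_cones_contractedFan.1 hσ
  obtain ⟨F, hF, hFG⟩ := (h _).1 hG
  obtain ⟨F', hF', hFH⟩ := (h _).1 hH
  have h1 : (F : Set α) \ {i} = G := by rw [← contractRay_sdiff, hFG, closureRay_sdiff]
  have h2 : (F' : Set α) \ {i} = H := by rw [← contractRay_sdiff, hFH, closureRay_sdiff]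
  rw [← Subtype.coe_le_coe, ← Subtype.coe_le_coe, ← h1, ← h2]
  exact (hC.total hF hF').imp Set.sdiff_subset_sdiff_left Set.sdiff_subset_sdiff_left

variable [M.Loopless]

theorem elementRay_coe (hflat : M.IsFlat {i}) (hi : ¬ M.IsColoop i) :
    (M.elementRay i hflat hi : Set α) = {i} := rfl

theorem closureRay_ne_elementRay (hflat : M.IsFlat {i}) (hi : ¬ M.IsColoop i)
    (G : (M ＼ {i}).NontrivialFlat) : M.closureRay i G ≠ M.elementRay i hflat hi := by
  intro h
  have h1 := closureRay_sdiff G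
  rw [h, elementRay_coe, Set.sdiff_self] at h1
  exact G.2.2.1.ne_empty h1.symm

theorem exists_mem_ground_delete (hflat : M.IsFlat {i}) (hi : ¬ M.IsColoop i) :
    ∃ j, j ∈ (M ＼ {i}).E := by
  by_contra! h
  have h1 : (M ＼ {i}).E = ∅ := Set.eq_empty_iff_forall_notMem.2 h
  have h2 := closure_ground_sdiff hi
  rw [← delete_ground, h1, M.isFlat_empty.closure] at h2
  have h3 : i ∈ M.E := hflat.subset_ground rfl
  rw [← h2] at h3
  exact h3

/-- The rays of the contracted fan: the ray of `i` and the rays of the closures of the nontrivial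
flats of the deletion. -/
def rayEquiv (hflat : M.IsFlat {i}) (hi : ¬ M.IsColoop i) :
    Option (M ＼ {i}).NontrivialFlat ≃ M.ContractedRay i :=
  Equiv.ofBijective (fun o => o.elim (M.elementRay i hflat hi) (M.closureRay i)) (by
    constructor
    · rintro (_ | G) (_ | H) h
      · rfl
      · exact absurd h.symm (closureRay_ne_elementRay hflat hi H)
      · exact absurd h (closureRay_ne_elementRay hflat hi G)
      · exact congrArg some (closureRay_injective h)
    · intro j
      by_cases hj : (j : Set α) = {i}
      · exact ⟨none, Subtype.ext hj.symm⟩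
      · exact ⟨some _, eq_closureRay hi j hj⟩)

@[simp]
theorem rayEquiv_none (hflat : M.IsFlat {i}) (hi : ¬ M.IsColoop i) :
    rayEquiv hflat hi none = M.elementRay i hflat hi := rfl

@[simp]
theorem rayEquiv_some (hflat : M.IsFlat {i}) (hi : ¬ M.IsColoop i)
    (G : (M ＼ {i}).NontrivialFlat) : rayEquiv hflat hi (some G) = M.closureRay i G := rfl

theorem sum_contractedRay [M.Finite] {R : Type*} [AddCommMonoid R] (hflat : M.IsFlat {i})
    (hi : ¬ M.IsColoop i) (f : M.ContractedRay i → R) :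
    ∑ r, f r = f (M.elementRay i hflat hi) + ∑ G, f (M.closureRay i G) := by
  rw [← (rayEquiv hflat hi).sum_comp, Fintype.sum_option]
  simp

theorem contractRay_eq_closureRay (hflat : M.IsFlat {i}) (hi : ¬ M.IsColoop i)
    {F : M.NontrivialFlat} {G : (M ＼ {i}).NontrivialFlat} (h : (F : Set α) \ {i} = G) :
    M.contractRay i F = M.closureRay i G := by
  rw [← contractRay_sdiff] at h
  obtain ⟨o, ho⟩ := (rayEquiv hflat hi).surjective (M.contractRay i F)
  rw [← ho] at h ⊢
  rcases o with _ | H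
  · rw [rayEquiv_none, elementRay_coe, Set.sdiff_self] at h
    exact absurd h.symm G.2.2.1.ne_empty
  · rw [rayEquiv_some, closureRay_sdiff] at h
    rw [rayEquiv_some, Subtype.ext h]

theorem contractRay_eq_elementRay (hflat : M.IsFlat {i}) (hi : ¬ M.IsColoop i)
    {F : M.NontrivialFlat} (h : (F : Set α) = {i}) :
    M.contractRay i F = M.elementRay i hflat hi := by
  have hs : (M.contractRay i F : Set α) ⊆ {i} := h ▸ contractRay_subset M i F
  exact Subtype.ext ((M.contractRay i F).2.1.2.1.subset_singleton_iff.1 hs)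

theorem isFlat_insert_of_mem_cones {hflat : M.IsFlat {i}} {hi : ¬ M.IsColoop i}
    {σ : Finset (M.ContractedRay i)} (hσ : σ ∈ (M.contractedFan i).cones)
    (h0 : M.elementRay i hflat hi ∈ σ) {G : (M ＼ {i}).NontrivialFlat}
    (hG : M.closureRay i G ∈ σ) : M.IsFlat (insert i (G : Set α)) := by
  obtain ⟨C, hC, h⟩ := mem_cones_contractedFan.1 hσ
  obtain ⟨F, hF, hF0⟩ := (h _).1 h0
  obtain ⟨F', hF', hFG⟩ := (h _).1 hG
  have h1 : (F : Set α) \ {i} = ∅ := by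
    rw [← contractRay_sdiff, hF0, elementRay_coe, Set.sdiff_self]
  have h2 : (F' : Set α) \ {i} = G := by rw [← contractRay_sdiff, hFG, closureRay_sdiff]
  have hFi : (F : Set α) = {i} := F.2.2.1.subset_singleton_iff.1 (Set.sdiff_eq_empty.1 h1)
  have hiF' : i ∈ (F' : Set α) := by
    rcases hC.total hF hF' with hle | hle
    · have : (F : Set α) ⊆ F' := hle
      exact this (hFi ▸ rfl)
    · have : (F' : Set α) ⊆ F := hle
      rw [hFi] at this
      rw [F'.2.2.1.subset_singleton_iff.1 this]
      rfl
  rw [← h2, Set.insert_sdiff_self_of_mem hiF']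
  exact F'.2.1

variable [M.Finite]

/-- A set of rays is a cone as soon as its members are pairwise compatible. -/
theorem mem_cones_of_forall {hflat : M.IsFlat {i}} {hi : ¬ M.IsColoop i}
    {σ : Finset (M.ContractedRay i)}
    (h1 : ∀ G H, M.closureRay i G ∈ σ → M.closureRay i H ∈ σ → G ≤ H ∨ H ≤ G)
    (h2 : M.elementRay i hflat hi ∈ σ → ∀ G, M.closureRay i G ∈ σ →
      M.IsFlat (insert i (G : Set α))) : σ ∈ (M.contractedFan i).cones := by
  classical
  rw [mem_cones_contractedFan]
  by_cases h0 : M.elementRay i hflat hi ∈ σ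
  · let C : Finset M.NontrivialFlat := Finset.univ.filter fun F =>
      (F : Set α) = {i} ∨ ∃ G, M.closureRay i G ∈ σ ∧ (F : Set α) = insert i (G : Set α)
    have hC : ∀ F, F ∈ C ↔ (F : Set α) = {i} ∨
        ∃ G, M.closureRay i G ∈ σ ∧ (F : Set α) = insert i (G : Set α) := by simp [C]
    refine ⟨C, ?_, fun r => ⟨fun hr => ?_, ?_⟩⟩
    · intro F hF F' hF' _
      change (F : Set α) ⊆ F' ∨ (F' : Set α) ⊆ F
      rcases (hC F).1 hF with e | ⟨G, hG, e⟩ <;> rcases (hC F').1 hF' with e' | ⟨G', hG', e'⟩ <;>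
        rw [e, e']
      · exact Or.inl subset_rfl
      · exact Or.inl (by simp)
      · exact Or.inr (by simp)
      · exact (h1 G G' hG hG').imp (Set.insert_subset_insert ·) (Set.insert_subset_insert ·)
    · obtain ⟨o, rfl⟩ := (rayEquiv hflat hi).surjective r
      rcases o with _ | G
      · exact ⟨⟨{i}, (M.elementRay i hflat hi).2.1⟩, (hC _).2 (Or.inl rfl),
          contractRay_eq_elementRay hflat hi rfl⟩
      · refine ⟨⟨_, isNontrivialFlat_insert G (h2 h0 G hr)⟩, (hC _).2 (Or.inr ⟨G, hr, rfl⟩),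
          contractRay_eq_closureRay hflat hi ?_⟩
        exact Set.insert_sdiff_self_of_notMem (notMem_of_nontrivialFlat_delete G)
    · rintro ⟨F, hF, rfl⟩
      rcases (hC F).1 hF with e | ⟨G, hG, e⟩
      · rwa [contractRay_eq_elementRay hflat hi e]
      · rwa [contractRay_eq_closureRay hflat hi (G := G)]
        rw [e, Set.insert_sdiff_self_of_notMem (notMem_of_nontrivialFlat_delete G)]
  · let C : Finset M.NontrivialFlat := Finset.univ.filter fun F =>
      ∃ G, M.closureRay i G ∈ σ ∧ (F : Set α) = M.closure G
    have hC : ∀ F, F ∈ C ↔ ∃ G, M.closureRay i G ∈ σ ∧ (F : Set α) = M.closure G := by simp [C]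
    refine ⟨C, ?_, fun r => ⟨fun hr => ?_, ?_⟩⟩
    · intro F hF F' hF' _
      obtain ⟨G, hG, e⟩ := (hC F).1 hF
      obtain ⟨G', hG', e'⟩ := (hC F').1 hF'
      change (F : Set α) ⊆ F' ∨ (F' : Set α) ⊆ F
      rw [e, e']
      exact (h1 G G' hG hG').imp (M.closure_subset_closure ·) (M.closure_subset_closure ·)
    · obtain ⟨o, rfl⟩ := (rayEquiv hflat hi).surjective r
      rcases o with _ | G
      · exact absurd hr h0
      · exact ⟨⟨_, (M.closureRay i G).2.1⟩, (hC _).2 ⟨G, hr, rfl⟩,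
          contractRay_eq_self (M.closureRay i G)⟩
    · rintro ⟨F, hF, rfl⟩
      obtain ⟨G, hG, e⟩ := (hC F).1 hF
      rwa [contractRay_eq_closureRay hflat hi (G := G)]
      rw [e, closure_sdiff_of_nontrivialFlat_delete]

end Deletion

/-! ### Transfer of the degree map from the deletion to the contracted fan -/

open scoped Classical in
theorem indicator_mem_apply (N : Matroid α) (F : Set α) (x : N.E) :
    Set.indicator {y : N.E | (y : α) ∈ F} (1 : N.E → ℝ) x = if (x : α) ∈ F then 1 else 0 := by
  simp [Set.indicator_apply]

/-- The linear function `e_x^* - e_y^*` on `ℝ^E / e_E`. -/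
def coordinateSub (N : Matroid α) (x y : N.E) : Module.Dual ℝ N.FanSpace :=
  (Submodule.span ℝ {(1 : N.E → ℝ)}).liftQ
    ((LinearMap.proj x : (N.E → ℝ) →ₗ[ℝ] ℝ) - LinearMap.proj y) (by
    rw [Submodule.span_le, Set.singleton_subset_iff, SetLike.mem_coe, LinearMap.mem_ker,
      LinearMap.sub_apply]
    simp)

open scoped Classical in
theorem coordinateSub_flatVector (N : Matroid α) (x y : N.E) (F : Set α) :
    N.coordinateSub x y (N.flatVector F) =
      (if (x : α) ∈ F then 1 else 0) - (if (y : α) ∈ F then 1 else 0) := by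
  rw [coordinateSub, flatVector, Submodule.liftQ_apply, LinearMap.sub_apply]
  simp [Set.indicator_apply]

open scoped Classical in
/-- The coefficients of a linear combination of the rays of the closures of the flats of `M ＼ i`
that represents the ray of `i` in the Chow ring. They come from the linear function
`e_i^* - e_j^*`. -/
def deletionCoeff (M : Matroid α) (i j : α) (G : (M ＼ {i}).NontrivialFlat) : ℝ :=
  (if j ∈ (G : Set α) then 1 else 0) - (if i ∈ M.closure G then 1 else 0)

section Transfer

variable {M : Matroid α} {i j : α}

open scoped Classical in
/-- The linear map `ℝ^(E \ i) / e → ℝ^E / e` that sends `e_j` to `e_j + e_i` and fixes the other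
`e_x`. -/
def spread (M : Matroid α) (i : α) (j : (M ＼ {i}).E) : (M ＼ {i}).FanSpace →ₗ[ℝ] M.FanSpace :=
  Submodule.mapQ _ _ (LinearMap.funLeft ℝ ℝ fun x : M.E =>
    if h : (x : α) = i then j else ⟨x, x.2, h⟩) (by
      rw [Submodule.span_le, Set.singleton_subset_iff]
      exact Submodule.mem_span_singleton_self (R := ℝ) (1 : M.E → ℝ))

theorem spread_flatVector (j : (M ＼ {i}).E) (G : (M ＼ {i}).NontrivialFlat) :
    spread M i j ((M ＼ {i}).flatVector G) =
      M.flatVector (M.closure G) + M.deletionCoeff i j G • M.flatVector {i} := by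
  classical
  rw [← mkQ_indicator M, ← mkQ_indicator M, ← map_smul, ← map_add]
  change (Submodule.span ℝ {(1 : M.E → ℝ)}).mkQ _ = _
  congr 1
  ext x
  change Set.indicator {y : (M ＼ {i}).E | (y : α) ∈ (G : Set α)} (1 : (M ＼ {i}).E → ℝ)
    (if h : (x : α) = i then j else ⟨x, x.2, h⟩) = _
  by_cases hx : (x : α) = i
  · rw [dif_pos hx, indicator_mem_apply (M ＼ {i})]
    simp [Set.indicator_apply, hx, deletionCoeff]
  · rw [dif_neg hx, indicator_mem_apply (M ＼ {i})]
    simp [Set.indicator_apply, hx, mem_closure_iff_of_ne G hx]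

variable [M.Finite]

/-- For `j ≠ i` and `j' ≠ i` the combinations differ by the linear function `e_j^* - e_j'^*`. -/
theorem toChow_sum_deletionCoeff {j' : α} (hj : j ∈ (M ＼ {i}).E) (hj' : j' ∈ (M ＼ {i}).E) :
    (M ＼ {i}).bergmanFan.toChow (∑ G, C (M.deletionCoeff i j G) * X G) =
      (M ＼ {i}).bergmanFan.toChow (∑ G, C (M.deletionCoeff i j' G) * X G) := by
  classical
  rw [← sub_eq_zero, ← map_sub,
    ← (M ＼ {i}).bergmanFan.toChow_linearForm ((M ＼ {i}).coordinateSub ⟨j, hj⟩ ⟨j', hj'⟩)]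
  congr 1
  rw [SimplicialFan.linearForm, ← Finset.sum_sub_distrib]
  refine Finset.sum_congr rfl fun G _ => ?_
  rw [bergmanFan_gen, coordinateSub_flatVector, ← sub_mul, ← C_sub, deletionCoeff, deletionCoeff]
  congr 2
  ring

theorem toChow_X_mul_X_eq_zero {N : Matroid α} [N.Finite] {G H : N.NontrivialFlat}
    (h : ¬ (G ≤ H ∨ H ≤ G)) : N.bergmanFan.toChow (X G * X H) = 0 := by
  classical
  have hne : G ≠ H := fun e => h (Or.inl e.le)
  have : (X G * X H : MvPolynomial N.NontrivialFlat ℝ) =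
      SimplicialFan.coneMonomial {G, H} := by
    simp [SimplicialFan.coneMonomial, Finset.prod_pair hne]
  rw [this]
  refine SimplicialFan.toChow_coneMonomial_eq_zero fun hc => h ?_
  exact (mem_cones_bergmanFan.1 hc).total (by simp) (by simp)

/-- If `G ∪ i` is not a flat, then for `j` in its closure the coefficients of all flats comparable
to `G` vanish. -/
theorem toChow_sum_deletionCoeff_mul_X (G : (M ＼ {i}).NontrivialFlat)
    (hj : j ∈ M.closure (insert i (G : Set α))) (hjG : j ∉ insert i (G : Set α)) :
    (M ＼ {i}).bergmanFan.toChow ((∑ H, C (M.deletionCoeff i j H) * X H) * X G) = 0 := by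
  classical
  rw [Finset.sum_mul, map_sum]
  refine Finset.sum_eq_zero fun H _ => ?_
  rw [mul_assoc, map_mul]
  by_cases hcomp : H ≤ G ∨ G ≤ H
  swap
  · rw [toChow_X_mul_X_eq_zero hcomp, mul_zero]
  have hji : j ≠ i := fun h => hjG (Set.mem_insert_iff.2 (Or.inl h))
  have hjG' : j ∉ (G : Set α) := fun h => hjG (Set.mem_insert_of_mem _ h)
  have hjcl : j ∉ M.closure G := fun h => hjG' ((mem_closure_iff_of_ne G hji).1 h)
  have hicl : i ∉ M.closure G := by
    intro h
    rw [closure_insert_eq_of_mem_closure h] at hj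
    exact hjcl hj
  have hcoeff : M.deletionCoeff i j H = 0 := by
    rw [deletionCoeff, sub_eq_zero]
    refine if_congr ?_ rfl rfl
    rcases hcomp with h | h
    · exact iff_of_false (fun h' => hjG' (h h')) fun h' => hicl (M.closure_subset_closure h h')
    · have hij : i ∈ M.closure (insert j (G : Set α)) := (closure_exchange ⟨hj, hjcl⟩).1
      rw [← mem_closure_iff_of_ne H hji]
      constructor
      · intro h'
        have hle : insert j (G : Set α) ⊆ M.closure H :=
          Set.insert_subset h' (Set.Subset.trans h (subset_closure_of_nontrivialFlat_delete H))
        have := M.closure_subset_closure hle hij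
        rwa [closure_closure] at this
      · intro h'
        have hle : insert i (G : Set α) ⊆ M.closure H :=
          Set.insert_subset h' (Set.Subset.trans h (subset_closure_of_nontrivialFlat_delete H))
        have := M.closure_subset_closure hle hj
        rwa [closure_closure] at this
  rw [hcoeff, C_0, map_zero, zero_mul]

variable [M.Loopless]

/-- The substitution of `∑ b_G ∂_G` for `∂_i` and of `∂_G` for the variable of the closure
of `G`. -/
def substitution (hflat : M.IsFlat {i}) (hi : ¬ M.IsColoop i)
    (b : (M ＼ {i}).NontrivialFlat → ℝ) :
    MvPolynomial (M.ContractedRay i) ℝ →ₐ[ℝ] MvPolynomial (M ＼ {i}).NontrivialFlat ℝ :=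
  aeval fun r => ((rayEquiv hflat hi).symm r).elim (∑ G, C (b G) * X G) X

variable (hflat : M.IsFlat {i}) (hi : ¬ M.IsColoop i)

@[simp]
theorem substitution_X_elementRay (b : (M ＼ {i}).NontrivialFlat → ℝ) :
    substitution hflat hi b (X (M.elementRay i hflat hi)) = ∑ G, C (b G) * X G := by
  rw [substitution, aeval_X, ← rayEquiv_none, Equiv.symm_apply_apply, Option.elim_none]

@[simp]
theorem substitution_X_closureRay (b : (M ＼ {i}).NontrivialFlat → ℝ)
    (G : (M ＼ {i}).NontrivialFlat) :
    substitution hflat hi b (X (M.closureRay i G)) = X G := by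
  rw [substitution, aeval_X, ← rayEquiv_some hflat hi, Equiv.symm_apply_apply, Option.elim_some]

theorem substitution_C (b : (M ＼ {i}).NontrivialFlat → ℝ) (a : ℝ) :
    substitution hflat hi b (C a) = C a :=
  (substitution hflat hi b).commutes a

theorem substitution_linearForm (j : (M ＼ {i}).E) (l : Module.Dual ℝ M.FanSpace) :
    substitution hflat hi (M.deletionCoeff i j) ((M.contractedFan i).linearForm l) =
      (M ＼ {i}).bergmanFan.linearForm (l ∘ₗ spread M i j) := by
  rw [SimplicialFan.linearForm, sum_contractedRay hflat hi, SimplicialFan.linearForm, map_add,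
    map_mul, substitution_C, substitution_X_elementRay, map_sum, Finset.mul_sum,
    ← Finset.sum_add_distrib]
  refine Finset.sum_congr rfl fun G _ => ?_
  rw [map_mul, substitution_C, substitution_X_closureRay, bergmanFan_gen, LinearMap.comp_apply,
    spread_flatVector, map_add, map_smul, smul_eq_mul, C_add, C_mul]
  change C (l (M.flatVector {i})) * _ + C (l (M.flatVector (M.closure G))) * _ = _
  ring

/-- The substitution is compatible with the relations of the Chow rings. -/
theorem toChow_substitution_eq_zero (hj : j ∈ (M ＼ {i}).E)
    {f : MvPolynomial (M.ContractedRay i) ℝ} (hf : f ∈ (M.contractedFan i).chowIdeal) :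
    (M ＼ {i}).bergmanFan.toChow (substitution hflat hi (M.deletionCoeff i j) f) = 0 := by
  classical
  have hle : (M.contractedFan i).chowIdeal ≤ RingHom.ker
      ((M ＼ {i}).bergmanFan.toChow.comp (substitution hflat hi (M.deletionCoeff i j))) := by
    refine sup_le (Ideal.span_le.2 ?_) (Ideal.span_le.2 ?_)
    · rintro _ ⟨σ, hσ, rfl⟩
      rw [SetLike.mem_coe, RingHom.mem_ker, AlgHom.comp_apply]
      have hdvd : ∀ r ∈ σ, ∀ s ∈ σ, r ≠ s →
          (X r * X s : MvPolynomial (M.ContractedRay i) ℝ) ∣ SimplicialFan.coneMonomial σ := by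
        intro r hr s hs hrs
        rw [← Finset.prod_pair (f := fun r => (X r : MvPolynomial (M.ContractedRay i) ℝ)) hrs]
        exact Finset.prod_dvd_prod_of_subset _ _ _ (by
          intro x hx
          rcases Finset.mem_insert.1 hx with rfl | hx
          · exact hr
          · exact Finset.mem_singleton.1 hx ▸ hs)
      have hzero : ∀ r ∈ σ, ∀ s ∈ σ, r ≠ s → (M ＼ {i}).bergmanFan.toChow
          (substitution hflat hi (M.deletionCoeff i j) (X r * X s)) = 0 →
          (M ＼ {i}).bergmanFan.toChow
          (substitution hflat hi (M.deletionCoeff i j) (SimplicialFan.coneMonomial σ)) = 0 := by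
        intro r hr s hs hrs h
        obtain ⟨g, hg⟩ := hdvd r hr s hs hrs
        rw [hg, map_mul, map_mul, h, zero_mul]
      by_contra hne
      refine hσ (mem_cones_of_forall (hflat := hflat) (hi := hi) (fun G H hG hH => ?_)
        fun h0 G hG => ?_)
      · by_contra hcomp
        refine hne (hzero _ hG _ hH (fun e => hcomp (Or.inl (closureRay_injective e).le)) ?_)
        rw [map_mul, substitution_X_closureRay, substitution_X_closureRay]
        exact toChow_X_mul_X_eq_zero hcomp
      · by_contra hG'
        refine hne (hzero _ h0 _ hG (closureRay_ne_elementRay hflat hi G).symm ?_)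
        have hsub : insert i (G : Set α) ⊆ M.E := Set.insert_subset
          (hflat.subset_ground rfl) (subset_ground_of_nontrivialFlat_delete G)
        obtain ⟨k, hk, hkG⟩ : ∃ k ∈ M.closure (insert i (G : Set α)), k ∉ insert i (G : Set α) := by
          by_contra! h
          exact hG' (isFlat_iff_closure_eq.2 (Set.Subset.antisymm h (M.subset_closure _ hsub)))
        have hkE : k ∈ (M ＼ {i}).E :=
          ⟨M.closure_subset_ground _ hk, fun h => hkG (Set.mem_insert_iff.2 (Or.inl h))⟩
        rw [map_mul, substitution_X_closureRay, substitution_X_elementRay, map_mul,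
          toChow_sum_deletionCoeff hj hkE, ← map_mul]
        exact toChow_sum_deletionCoeff_mul_X G hk hkG
    · rintro _ ⟨l, rfl⟩
      rw [SetLike.mem_coe, RingHom.mem_ker, AlgHom.comp_apply]
      rw [substitution_linearForm hflat hi ⟨j, hj⟩]
      exact SimplicialFan.toChow_linearForm _ _
  exact hle hf

theorem toChow_X_elementRay (hj : j ∈ (M ＼ {i}).E) :
    (M.contractedFan i).toChow (X (M.elementRay i hflat hi)) =
      (M.contractedFan i).toChow (∑ G, C (M.deletionCoeff i j G) * X (M.closureRay i G)) := by
  classical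
  have hji : j ≠ i := fun h => hj.2 h
  rw [← sub_eq_zero, ← map_sub, ← (M.contractedFan i).toChow_linearForm
    (M.coordinateSub ⟨i, hflat.subset_ground rfl⟩ ⟨j, hj.1⟩)]
  congr 1
  rw [SimplicialFan.linearForm, sum_contractedRay hflat hi, sub_eq_add_neg,
    ← Finset.sum_neg_distrib]
  congr 1
  · change _ = C (M.coordinateSub _ _ (M.flatVector {i})) * _
    rw [coordinateSub_flatVector]
    simp [hji]
  · refine Finset.sum_congr rfl fun G _ => ?_
    change _ = C (M.coordinateSub _ _ (M.flatVector (M.closure G))) * _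
    rw [coordinateSub_flatVector, ← neg_mul, ← C_neg]
    simp only [mem_closure_iff_of_ne G hji, deletionCoeff, neg_sub]

end Transfer

/-! ### The degree on cones that contain the ray of the deleted element -/

section Normalization

variable {M : Matroid α} [M.Finite] [M.Loopless] {i : α} {d : ℕ}

/-- If the cone `S ∪ {i}` of the contracted fan is of dimension `d`, then no flat that extends `S`
has `i` in its closure: otherwise its closure would extend a chain of `d` nontrivial flats. -/
theorem notMem_closure_of_mem_link (hd : M.eRank ≤ d + 1) (hflat : M.IsFlat {i})
    (hi : ¬ M.IsColoop i) {S : Finset (M ＼ {i}).NontrivialFlat}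
    (hS : IsChain (· ≤ ·) (S : Set (M ＼ {i}).NontrivialFlat))
    (hflats : ∀ G ∈ S, M.IsFlat (insert i (G : Set α))) (hc : S.card + 1 = d)
    {H : (M ＼ {i}).NontrivialFlat} (hH : H ∈ (M ＼ {i}).bergmanFan.link S) :
    i ∉ M.closure H := by
  classical
  intro hiH
  rw [mem_link_bergmanFan hS] at hH
  have hall : ∀ G ∈ insert H S, M.IsFlat (insert i (G : Set α)) := by
    intro G hG
    rcases Finset.mem_insert.1 hG with rfl | hG
    · rw [← closure_eq_insert_of_mem G hiH]
      exact M.isFlat_closure _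
    · exact hflats G hG
  have hch : IsChain (· ≤ ·) ((insert H S : Finset _) : Set (M ＼ {i}).NontrivialFlat) := by
    rw [Finset.coe_insert]
    exact hS.insert fun F hF _ => (hH.2 F hF).symm
  let f : {G // G ∈ insert H S} → M.NontrivialFlat := fun G =>
    ⟨insert i (G.1 : Set α), isNontrivialFlat_insert G.1 (hall G.1 G.2)⟩
  have hf : Function.Injective f := by
    intro G G' h
    have h' : insert i (G.1 : Set α) = insert i (G'.1 : Set α) := congrArg Subtype.val h
    refine Subtype.ext (Subtype.ext ?_)
    rw [← Set.insert_sdiff_self_of_notMem (notMem_of_nontrivialFlat_delete G.1), h',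
      Set.insert_sdiff_self_of_notMem (notMem_of_nontrivialFlat_delete G'.1)]
  let e : M.NontrivialFlat := ⟨{i}, (M.elementRay i hflat hi).2.1⟩
  have he : e ∉ Finset.univ.image f := by
    intro h
    obtain ⟨G, -, hG⟩ := Finset.mem_image.1 h
    have hG' : insert i (G.1 : Set α) = {i} := congrArg Subtype.val hG
    obtain ⟨x, hx⟩ := G.1.2.2.1
    have hxi : x ∈ ({i} : Set α) := hG' ▸ Set.mem_insert_of_mem i hx
    exact notMem_of_nontrivialFlat_delete G.1 (hxi ▸ hx)
  have hT : IsChain (· ≤ ·)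
      ((insert e (Finset.univ.image f) : Finset M.NontrivialFlat) : Set M.NontrivialFlat) := by
    rw [Finset.coe_insert, Finset.coe_image]
    refine IsChain.insert ?_ ?_
    · rintro _ ⟨G, -, rfl⟩ _ ⟨G', -, rfl⟩ _
      exact (hch.total G.2 G'.2).imp (Set.insert_subset_insert ·) (Set.insert_subset_insert ·)
    · rintro _ ⟨G, -, rfl⟩ _
      exact Or.inl (Set.singleton_subset_iff.2 (Set.mem_insert i _))
  have hcard := card_le_of_isChain hd hT
  rw [Finset.card_insert_of_notMem he, Finset.card_image_of_injective _ hf, Finset.card_univ,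
    Fintype.card_coe, Finset.card_insert_of_notMem hH.1] at hcard
  omega

/-- If `S ∪ {i}` is a cone of dimension `d`, then `∂_i` can be represented by a combination of flats
that involves no flat of `S` and whose coefficients on the flats extending `S` add up to `1`. With
`A` the largest member of `S` whose closure does not contain `i` and `B` the smallest
one whose closure contains `i`, any `j ∈ B \ A` will do. -/
theorem exists_deletionCoeff (hd : M.eRank ≤ d + 1) (hflat : M.IsFlat {i})
    (hi : ¬ M.IsColoop i) {S : Finset (M ＼ {i}).NontrivialFlat}
    (hS : IsChain (· ≤ ·) (S : Set (M ＼ {i}).NontrivialFlat))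
    (hflats : ∀ G ∈ S, M.IsFlat (insert i (G : Set α))) (hc : S.card + 1 = d) :
    ∃ j ∈ (M ＼ {i}).E, (∀ H ∈ S, M.deletionCoeff i j H = 0) ∧
      ∑ H ∈ (M ＼ {i}).bergmanFan.link S, M.deletionCoeff i j H = 1 := by
  classical
  have : (M ＼ {i}).Loopless := (M.delete_isRestriction {i}).loopless
  have hdN : (M ＼ {i}).eRank ≤ d + 1 := (M.eRk_le_eRank (M.E \ {i})).trans hd
  obtain ⟨A, hAm, hiA, hAfl, hAmax⟩ : ∃ A : Set α, (A = ∅ ∨ ∃ G ∈ S, (G : Set α) = A) ∧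
      i ∉ M.closure A ∧ M.IsFlat (insert i A) ∧ ∀ G ∈ S, i ∉ M.closure G → (G : Set α) ⊆ A := by
    by_cases h : (S.filter fun G : (M ＼ {i}).NontrivialFlat => i ∉ M.closure G).Nonempty
    · obtain ⟨F, hF⟩ := Finset.exists_maximal h
      have hF' := Finset.mem_filter.1 hF.1
      refine ⟨F, Or.inr ⟨F, hF'.1, rfl⟩, hF'.2, hflats F hF'.1, fun G hG hGi => ?_⟩
      rcases hS.total hG hF'.1 with h' | h'
      · exact h'
      · exact hF.2 (Finset.mem_filter.2 ⟨hG, hGi⟩) h'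
    · refine ⟨∅, Or.inl rfl, ?_, by simpa using hflat, fun F hF hFi =>
        absurd ⟨F, Finset.mem_filter.2 ⟨hF, hFi⟩⟩ h⟩
      rw [M.isFlat_empty.closure]
      exact Set.notMem_empty i
  obtain ⟨B, hBm, hBfl, hiB, hBmin⟩ : ∃ B : Set α,
      (B = (M ＼ {i}).E ∨ ∃ G ∈ S, (G : Set α) = B) ∧ (M ＼ {i}).IsFlat B ∧
      i ∈ M.closure B ∧ ∀ G ∈ S, i ∈ M.closure G → B ⊆ G := by
    by_cases h : (S.filter fun G : (M ＼ {i}).NontrivialFlat => i ∈ M.closure G).Nonempty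
    · obtain ⟨F, hF⟩ := Finset.exists_minimal h
      have hF' := Finset.mem_filter.1 hF.1
      refine ⟨F, Or.inr ⟨F, hF'.1, rfl⟩, F.2.1, hF'.2, fun G hG hGi => ?_⟩
      rcases hS.total hG hF'.1 with h' | h'
      · exact hF.2 (Finset.mem_filter.2 ⟨hG, hGi⟩) h'
      · exact h'
    · refine ⟨(M ＼ {i}).E, Or.inl rfl, (M ＼ {i}).ground_isFlat, ?_, fun F hF hFi =>
        absurd ⟨F, Finset.mem_filter.2 ⟨hF, hFi⟩⟩ h⟩
      rw [delete_ground, closure_ground_sdiff hi]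
      exact hflat.subset_ground rfl
  have hAB : A ⊆ B := by
    rcases hAm with rfl | ⟨F, hF, rfl⟩
    · exact Set.empty_subset _
    · rcases hBm with rfl | ⟨F', hF', rfl⟩
      · exact F.2.1.subset_ground
      · rcases hS.total hF hF' with h | h
        · exact h
        · exact absurd (M.closure_subset_closure h hiB) hiA
  obtain ⟨j, hjB, hjA⟩ : ∃ j ∈ B, j ∉ A := by
    by_contra! h
    exact hiA (M.closure_subset_closure h hiB)
  have hjE : j ∈ (M ＼ {i}).E := hBfl.subset_ground hjB
  have hins : insert j A ⊆ (M ＼ {i}).E :=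
    Set.insert_subset hjE (hAB.trans hBfl.subset_ground)
  -- By the exchange property `i` is not in the closure of `A ∪ j`.
  have hij : i ∉ M.closure (insert j A) := by
    intro h
    have h1 : j ∈ M.closure (insert i A) := (closure_exchange ⟨h, hiA⟩).1
    rw [hAfl.closure] at h1
    exact h1.elim hjE.2 hjA
  have hcl : (M ＼ {i}).closure (insert j A) = M.closure (insert j A) := by
    rw [delete_closure_eq_of_disjoint M
      (Set.disjoint_singleton_right.2 fun h => (hins h).2 rfl), Set.sdiff_singleton_eq_self hij]
  have hsub : insert j A ⊆ (M ＼ {i}).closure (insert j A) := (M ＼ {i}).subset_closure _ hins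
  let H₀ : (M ＼ {i}).NontrivialFlat := ⟨(M ＼ {i}).closure (insert j A),
    (M ＼ {i}).isFlat_closure _, ⟨j, hsub (Set.mem_insert _ _)⟩, fun h => hij (by
      rw [← closure_closure, ← hcl, h, delete_ground, closure_ground_sdiff hi]
      exact hflat.subset_ground rfl)⟩
  have hjH₀ : j ∈ (H₀ : Set α) := hsub (Set.mem_insert _ _)
  have hiH₀ : i ∉ M.closure H₀ := by
    change i ∉ M.closure ((M ＼ {i}).closure (insert j A))
    rwa [hcl, closure_closure]
  have hH₀ : H₀ ∈ (M ＼ {i}).bergmanFan.link S := by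
    refine (mem_link_bergmanFan hS).2 ⟨fun h => hjA (hAmax H₀ h hiH₀ hjH₀), fun G hG => ?_⟩
    by_cases hiG : i ∈ M.closure G
    · exact Or.inr ((hBfl.closure_insert_subset hAB hjB).trans (hBmin G hG hiG))
    · exact Or.inl ((hAmax G hG hiG).trans ((Set.subset_insert _ _).trans hsub))
  refine ⟨j, hjE, fun H hH => ?_, ?_⟩
  · rw [deletionCoeff]
    by_cases hiH : i ∈ M.closure H
    · rw [if_pos hiH, if_pos (hBmin H hH hiH hjB), sub_self]
    · rw [if_neg hiH, if_neg fun h => hjA (hAmax H hH hiH h), sub_self]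
  · obtain ⟨A', B', hA', -, hlink, hpart⟩ := exists_gap hdN hS hc ⟨H₀, hH₀⟩
    have hgap := (hlink H₀).1 hH₀
    have hjA' : j ∉ A' := by
      rcases hA' with rfl | ⟨F, hF, rfl⟩
      · exact Set.notMem_empty j
      · exact fun h => hjA (hAmax F hF
          (fun h' => hiH₀ (M.closure_subset_closure hgap.1.subset h')) h)
    obtain ⟨H, ⟨hH, hjH⟩, huniq⟩ := hpart j (hgap.2.subset hjH₀) hjA'
    have hi' := fun H hH => notMem_closure_of_mem_link hd hflat hi hS hflats hc (H := H) hH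
    rw [Finset.sum_eq_single_of_mem H hH, deletionCoeff, if_pos hjH, if_neg (hi' H hH), sub_zero]
    intro H' hH' hne
    rw [deletionCoeff, if_neg fun h => hne (huniq H' ⟨hH', h⟩), if_neg (hi' H' hH'), sub_zero]

/-- The degree of `∂_S ∑ b_H ∂_H`, when no flat of `S` occurs in the combination. -/
theorem map_sum_mul_coneMonomial {N : Matroid α} [N.Finite]
    {φ : MvPolynomial N.NontrivialFlat ℝ →ₗ[ℝ] ℝ}
    (hφ : N.bergmanFan.IsDegreeFunctional d φ) {S : Finset N.NontrivialFlat} (hc : S.card + 1 = d)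
    (b : N.NontrivialFlat → ℝ) (hb : ∀ H ∈ S, b H = 0) :
    φ ((∑ H, C (b H) * X H) * SimplicialFan.coneMonomial S) = ∑ H ∈ N.bergmanFan.link S, b H := by
  classical
  rw [Finset.sum_mul, map_sum, ← Finset.sum_subset (Finset.subset_univ (N.bergmanFan.link S))]
  · refine Finset.sum_congr rfl fun H hH => ?_
    have hH' := SimplicialFan.mem_link.1 hH
    rw [mul_assoc, ← SimplicialFan.coneMonomial_insert hH'.1, ← smul_eq_C_mul, map_smul,
      hφ.map_cone _ hH'.2 (by rw [Finset.card_insert_of_notMem hH'.1, hc]), smul_eq_mul, mul_one]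
  · intro H _ hH
    by_cases hHS : H ∈ S
    · rw [hb H hHS, C_0, zero_mul, zero_mul, map_zero]
    · rw [mul_assoc, ← SimplicialFan.coneMonomial_insert hHS, ← smul_eq_C_mul, map_smul,
        hφ.map_chowIdeal, smul_zero]
      exact SimplicialFan.toChow_eq_zero_iff.1 (SimplicialFan.toChow_coneMonomial_eq_zero
        fun h => hH (SimplicialFan.mem_link.2 ⟨hHS, h⟩))

/-- The degree functional of the deletion induces one of the contracted fan. -/
theorem isDegreeFunctional_substitution (hd : M.eRank ≤ d + 1) (hflat : M.IsFlat {i})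
    (hi : ¬ M.IsColoop i) {j : α} (hj : j ∈ (M ＼ {i}).E)
    {φ : MvPolynomial (M ＼ {i}).NontrivialFlat ℝ →ₗ[ℝ] ℝ}
    (hφ : (M ＼ {i}).bergmanFan.IsDegreeFunctional d φ) :
    (M.contractedFan i).IsDegreeFunctional d
      (φ ∘ₗ (substitution hflat hi (M.deletionCoeff i j)).toLinearMap) where
  map_chowIdeal f hf := by
    rw [LinearMap.comp_apply, AlgHom.toLinearMap_apply]
    exact hφ.map_chowIdeal _ (SimplicialFan.toChow_eq_zero_iff.1
      (toChow_substitution_eq_zero hflat hi hj hf))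
  map_cone σ hσ hc := by
    classical
    rw [LinearMap.comp_apply, AlgHom.toLinearMap_apply]
    let S : Finset (M ＼ {i}).NontrivialFlat := Finset.univ.filter fun G => M.closureRay i G ∈ σ
    have hSmem : ∀ G, G ∈ S ↔ M.closureRay i G ∈ σ := by simp [S]
    have hS : IsChain (· ≤ ·) (S : Set (M ＼ {i}).NontrivialFlat) := fun G hG H hH _ =>
      total_of_mem_cones hσ ((hSmem G).1 hG) ((hSmem H).1 hH)
    have himage : ∀ r, r ∈ S.image (M.closureRay i) ↔ r ∈ σ ∧ r ≠ M.elementRay i hflat hi := by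
      intro r
      rw [Finset.mem_image]
      constructor
      · rintro ⟨G, hG, rfl⟩
        exact ⟨(hSmem G).1 hG, closureRay_ne_elementRay hflat hi G⟩
      · rintro ⟨hr, hne⟩
        obtain ⟨o, rfl⟩ := (rayEquiv hflat hi).surjective r
        rcases o with _ | G
        · exact absurd rfl hne
        · exact ⟨G, (hSmem G).2 hr, rfl⟩
    have hprod : substitution hflat hi (M.deletionCoeff i j)
        (SimplicialFan.coneMonomial (S.image (M.closureRay i))) =
        SimplicialFan.coneMonomial S := by
      rw [SimplicialFan.coneMonomial, Finset.prod_image closureRay_injective.injOn, map_prod,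
        SimplicialFan.coneMonomial]
      exact Finset.prod_congr rfl fun G _ => substitution_X_closureRay hflat hi _ G
    by_cases h0 : M.elementRay i hflat hi ∈ σ
    · have hnot : M.elementRay i hflat hi ∉ S.image (M.closureRay i) :=
        fun h => ((himage _).1 h).2 rfl
      have hσS : σ = insert (M.elementRay i hflat hi) (S.image (M.closureRay i)) := by
        ext r
        rw [Finset.mem_insert, himage]
        by_cases hr : r = M.elementRay i hflat hi
        · simp [hr, h0]
        · simp [hr]
      have hcard : S.card + 1 = d := by
        rw [← hc, hσS, Finset.card_insert_of_notMem hnot,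
          Finset.card_image_of_injective _ closureRay_injective]
      obtain ⟨j', hj', hzero, hsum⟩ := exists_deletionCoeff hd hflat hi hS
        (fun G hG => isFlat_insert_of_mem_cones hσ h0 ((hSmem G).1 hG)) hcard
      rw [hσS, SimplicialFan.coneMonomial_insert hnot, map_mul, hprod, substitution_X_elementRay,
        ← hsum, ← map_sum_mul_coneMonomial hφ hcard _ hzero]
      exact hφ.map_eq (by rw [map_mul, toChow_sum_deletionCoeff hj hj', ← map_mul])
    · have hσS : σ = S.image (M.closureRay i) := by
        ext r
        rw [himage]
        exact ⟨fun hr => ⟨hr, fun h => h0 (h ▸ hr)⟩, fun h => h.1⟩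
      rw [hσS, hprod]
      refine hφ.map_cone S (mem_cones_bergmanFan.2 hS) ?_
      rw [← hc, hσS, Finset.card_image_of_injective _ closureRay_injective]

end Normalization

/-! ### Comparison of the mixed volumes -/

theorem eval_aeval_X_add_C_mul_X {ι κ : Type*} (r : ι → κ) (e : κ) (b : ι → ℝ) (t : κ → ℝ)
    (p : MvPolynomial ι ℝ) :
    eval t (aeval (fun G => (X (r G) + C (b G) * X e : MvPolynomial κ ℝ)) p) =
      eval (fun G => t (r G) + b G * t e) p := by
  have hcomp : (aeval t).comp (aeval fun G => (X (r G) + C (b G) * X e : MvPolynomial κ ℝ)) =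
      (aeval fun G => t (r G) + b G * t e) :=
    algHom_ext fun G => by simp
  exact AlgHom.congr_fun hcomp p

/-- The volume polynomials are compared at each point, where they are degrees of powers of a
piecewise linear function, up to the factor `1 / d!`. -/
theorem mixedVolume_contractedFan_eq {M : Matroid α} [M.Finite] [M.Loopless] {i : α} {d : ℕ}
    (hflat : M.IsFlat {i}) (hi : ¬ M.IsColoop i) {j : α}
    (hj : j ∈ (M ＼ {i}).E) {φ : MvPolynomial (M ＼ {i}).NontrivialFlat ℝ →ₗ[ℝ] ℝ}
    (hφ : (M ＼ {i}).bergmanFan.IsDegreeFunctional d φ)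
    (hψ : (M.contractedFan i).IsDegreeFunctional d
      (φ ∘ₗ (substitution hflat hi (M.deletionCoeff i j)).toLinearMap))
    (b : (M ＼ {i}).NontrivialFlat → ℝ)
    (hb : (M.contractedFan i).toChow (X (M.elementRay i hflat hi)) =
      (M.contractedFan i).toChow (∑ G, C (b G) * X (M.closureRay i G))) :
    (M.contractedFan i).mixedVolume d =
      aeval (fun G => X (M.closureRay i G) + C (b G) * X (M.elementRay i hflat hi))
        ((M ＼ {i}).bergmanFan.mixedVolume d) := by
  refine MvPolynomial.funext fun t => ?_
  -- In the Chow ring of the deletion, the given coefficients and the standard ones agree.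
  have hbj : (M ＼ {i}).bergmanFan.toChow (∑ G, C (M.deletionCoeff i j G) * X G) =
      (M ＼ {i}).bergmanFan.toChow (∑ G, C (b G) * X G) := by
    have h := toChow_substitution_eq_zero hflat hi hj (SimplicialFan.toChow_eq_iff.1 hb)
    rw [map_sub, substitution_X_elementRay, map_sum, map_sub, sub_eq_zero] at h
    rw [h]
    congr 1
    refine Finset.sum_congr rfl fun G _ => ?_
    rw [map_mul, substitution_C, substitution_X_closureRay]
  have hlin : (M ＼ {i}).bergmanFan.toChow (substitution hflat hi (M.deletionCoeff i j)
      (∑ r, C (t r) * X r)) = (M ＼ {i}).bergmanFan.toChow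
      (∑ G, C (t (M.closureRay i G) + b G * t (M.elementRay i hflat hi)) * X G) := by
    rw [sum_contractedRay hflat hi, map_add, map_mul, substitution_C, substitution_X_elementRay,
      map_add, map_mul, hbj, ← map_mul, ← map_add, map_sum, Finset.mul_sum,
      ← Finset.sum_add_distrib]
    congr 1
    refine Finset.sum_congr rfl fun G _ => ?_
    rw [map_mul, substitution_C, substitution_X_closureRay, C_add, C_mul]
    ring
  have hpow : (M ＼ {i}).bergmanFan.toChow (substitution hflat hi (M.deletionCoeff i j)
      (∑ r, C (t r) * X r) ^ d) = (M ＼ {i}).bergmanFan.toChow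
      ((∑ G, C (t (M.closureRay i G) + b G * t (M.elementRay i hflat hi)) * X G) ^ d) := by
    rw [map_pow, hlin, ← map_pow]
  rw [eval_aeval_X_add_C_mul_X, hψ.eval_mixedVolume, hφ.eval_mixedVolume, LinearMap.comp_apply,
    AlgHom.toLinearMap_apply, map_pow, hφ.map_eq hpow]

end Matroid

open Matroid in
theorem mainTheorem4 {α : Type*} (M : Matroid α) [M.Finite] [M.Loopless] (d : ℕ)
    (hd : M.eRank = d + 1) (i : α) (hflat : M.IsFlat {i}) (hi : ¬ M.IsColoop i) :
    (∃! φ, (M ＼ {i}).bergmanFan.IsDegreeMap d φ) ∧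
    (∃! φ, (M.contractedFan i).IsDegreeMap d φ) ∧
    (∃ b : (M ＼ {i}).NontrivialFlat → ℝ,
      (M.contractedFan i).toChow (X (M.elementRay i hflat hi)) =
        (M.contractedFan i).toChow (∑ G, C (b G) * X (M.closureRay i G))) ∧
    ∀ b : (M ＼ {i}).NontrivialFlat → ℝ,
      (M.contractedFan i).toChow (X (M.elementRay i hflat hi)) =
        (M.contractedFan i).toChow (∑ G, C (b G) * X (M.closureRay i G)) →
      (M.contractedFan i).mixedVolume d =
        aeval (fun G => X (M.closureRay i G) + C (b G) * X (M.elementRay i hflat hi))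
          ((M ＼ {i}).bergmanFan.mixedVolume d) := by
  have : (M ＼ {i}).Loopless := (M.delete_isRestriction {i}).loopless
  obtain ⟨j, hj⟩ := exists_mem_ground_delete hflat hi
  have hdN : (M ＼ {i}).eRank ≤ d + 1 := (M.eRk_le_eRank (M.E \ {i})).trans hd.le
  obtain ⟨φ, hφ⟩ : ∃ φ, (M ＼ {i}).bergmanFan.IsDegreeFunctional d φ :=
    ⟨_, (isBalanced_bergmanFan hdN).isDegreeFunctional⟩
  have hψ := isDegreeFunctional_substitution hd.le hflat hi hj hφ
  exact ⟨hφ.existsUnique, hψ.existsUnique,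
    ⟨M.deletionCoeff i j, toChow_X_elementRay hflat hi hj⟩,
    mixedVolume_contractedFan_eq hflat hi hj hφ hψ⟩
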